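/- Let $N\ge 0$ be an integer, $a>0$, $\eta>0$, let $B\subset\mathbb R^3$ be the ball of radius $a$ centred at the origin, and let $d\sigma$ be the surface measure on $\partial B$. Let $H^{1/2}(\partial B)=H^{1/2}(\partial B;\mathbb R^3)$ be the Sobolev space of all $u\in L^2(\partial B;\mathbb R^3)$ with finite norm $$\|u\|^2=\int_{\partial B}|u|^2\,d\sigma+\int_{\partial B}\int_{\partial B}\frac{|u(r)-u(s)|^2}{|r-s|^3}\,d\sigma(r)\,d\sigma(s),$$ let $H^{-1/2}(\partial B)$ be its dual, in which $L^2(\partial B;\mathbb R^3)$ is embedded through $\langle f,\varphi\rangle=\int_{\partial B} f\cdot\varphi\,d\sigma$, and put $H^{\pm1/2}_N=(H^{\pm1/2}(\partial B))^N$. Let $$G(r)=\frac1{8\pi\eta}\Big(\frac{\mathrm{Id}}{|r|}+\frac{r\otimes r}{|r|^3}\Big)\quad(r\in\mathbb R^3\setminus\{0\}),\qquad S_N=\{x\in(\mathbb R^3)^N:\ |x_i-x_j|>2a\ \text{ for all } i<j\}.$$ Then for every $x\in S_N$ the single-layer (Neumann-to-Dirichlet) formula $$(T_xf)_i(r)=\sum_{j=1}^N\int_{\partial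 B}G(x_i-x_j+r-s)\,f_j(s)\,d\sigma(s)=:\sum_{j=1}^N\langle f_j,G(x_i-x_j+r-\cdot)\rangle_{\partial B},\qquad r\in\partial B,$$ defines a unique bounded linear operator $T_x:H^{-1/2}_N\to H^{1/2}_N$. That is, there is exactly one bounded linear operator for which, for almost every $r\in\partial B$, the formula holds with absolutely convergent integrals when all $f_j\in L^2(\partial B;\mathbb R^3)$, and for which the contribution of $f_j\in H^{-1/2}(\partial B)$ to the $i$-th component is, for $j\ne i$, the duality pairing of $f_j$ with the smooth kernel $s\mapsto G(x_i-x_j+r-s)$. Moreover, the map $x\mapsto T_x$ is real-analytic from the open set $S_N$ into the Banach space $\mathcal L(H^{-1/2}_N,H^{1/2}_N)$: around every $x_0\in S_N$ it is the sum of a power series in $x-x_0$ that converges in operator norm. -/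

import Mathlib

open MeasureTheory

namespace Stokes

/-- Physical space `ℝ³` with its Euclidean norm. -/
abbrev E3 : Type := EuclideanSpace ℝ (Fin 3)

/-- The surface measure of `∂B`, where `B` is the ball of radius `a` centred at `0`, as a measure
on `ℝ³` carried by `∂B`: the image of the surface measure of the unit sphere under `ω ↦ a ω`,
multiplied by `a ^ 2`. -/
noncomputable def surf (a : ℝ) : Measure E3 :=
  (a ^ 2).toNNReal • ((volume : Measure E3).toSphere).map
    (fun ω : Metric.sphere (0 : E3) 1 => a • (ω : E3))

instance surf_isFiniteMeasure (a : ℝ) : IsFiniteMeasure (surf a) := by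
  unfold surf; infer_instance

/-- The Slobodeckij measure `|r - s| ^ (-3) dσ(r) dσ(s)` on `∂B × ∂B`; the exponent is
`dim (∂B) + 2 * (1 / 2) = 3`. The diagonal is a null set of `σ ⊗ σ`. -/
noncomputable def slobMeasure (a : ℝ) : Measure (E3 × E3) :=
  ((surf a).prod (surf a)).withDensity (fun q => ENNReal.ofReal ((‖q.1 - q.2‖ ^ 3)⁻¹))

/-- `L²(∂B; ℝ³)`. -/
abbrev L2 (a : ℝ) : Type := Lp E3 2 (surf a)

theorem slob_fst (a : ℝ) :
    Measure.QuasiMeasurePreserving Prod.fst (slobMeasure a) (surf a) :=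
  Measure.quasiMeasurePreserving_fst.mono_left (withDensity_absolutelyContinuous _ _)

theorem slob_snd (a : ℝ) :
    Measure.QuasiMeasurePreserving Prod.snd (slobMeasure a) (surf a) :=
  Measure.quasiMeasurePreserving_snd.mono_left (withDensity_absolutelyContinuous _ _)

/-- The graph of `u ↦ ((r, s) ↦ u r - u s)` from `L²(∂B; ℝ³)` to `L²(|r - s|⁻³ dσ dσ)`. -/
noncomputable def halfGraph (a : ℝ) :
    Submodule ℝ (WithLp 2 (L2 a × Lp E3 2 (slobMeasure a))) where
  carrier := {p | p.snd =ᵐ[slobMeasure a] fun q => p.fst q.1 - p.fst q.2}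
  zero_mem' := by
    have h1 := (slob_fst a).ae (Lp.coeFn_zero E3 2 (surf a))
    have h2 := (slob_snd a).ae (Lp.coeFn_zero E3 2 (surf a))
    have h3 := Lp.coeFn_zero E3 2 (slobMeasure a)
    filter_upwards [h1, h2, h3] with q h1 h2 h3
    simp only [WithLp.zero_snd, WithLp.zero_fst]
    rw [h1, h2, h3]; simp
  add_mem' := by
    intro p p' hp hp'
    have h1 := (slob_fst a).ae (Lp.coeFn_add p.fst p'.fst)
    have h2 := (slob_snd a).ae (Lp.coeFn_add p.fst p'.fst)
    have h3 := Lp.coeFn_add p.snd p'.snd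
    change (p + p').snd =ᵐ[slobMeasure a] fun q => (p + p').fst q.1 - (p + p').fst q.2
    filter_upwards [h1, h2, h3, hp, hp'] with q h1 h2 h3 hp hp'
    simp only [WithLp.add_snd, WithLp.add_fst]
    rw [h1, h2, h3]
    simp only [Pi.add_apply]
    rw [hp, hp']; abel
  smul_mem' := by
    intro c p hp
    have h1 := (slob_fst a).ae (Lp.coeFn_smul c p.fst)
    have h2 := (slob_snd a).ae (Lp.coeFn_smul c p.fst)
    have h3 := Lp.coeFn_smul c p.snd
    change (c • p).snd =ᵐ[slobMeasure a] fun q => (c • p).fst q.1 - (c • p).fst q.2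
    filter_upwards [h1, h2, h3, hp] with q h1 h2 h3 hp
    simp only [WithLp.smul_snd, WithLp.smul_fst]
    rw [h1, h2, h3]
    simp only [Pi.smul_apply]
    rw [hp, smul_sub]

/-- The Sobolev space `H^{1/2}(∂B; ℝ³)`: all `u ∈ L²(∂B; ℝ³)` with
`∬ |u r - u s|² / |r - s|³ dσ(r) dσ(s) < ∞`. An element is stored together with its difference
function `(r, s) ↦ u r - u s` (which `u` determines), so that the inherited Hilbert norm is the
Slobodeckij norm `‖u‖² = ∫ |u|² dσ + ∬ |u r - u s|² / |r - s|³ dσ(r) dσ(s)`. -/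
def HHalf (a : ℝ) : Type := halfGraph a

noncomputable instance (a : ℝ) : NormedAddCommGroup (HHalf a) :=
  inferInstanceAs (NormedAddCommGroup (halfGraph a))

noncomputable instance (a : ℝ) : InnerProductSpace ℝ (HHalf a) :=
  inferInstanceAs (InnerProductSpace ℝ (halfGraph a))

/-- `H^{-1/2}(∂B; ℝ³)`, the dual of `H^{1/2}(∂B; ℝ³)` with the dual norm. -/
abbrev HNegHalf (a : ℝ) : Type := StrongDual ℝ (HHalf a)

/-- The embedding `H^{1/2}(∂B; ℝ³) → L²(∂B; ℝ³)`: the underlying function of an element. -/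
noncomputable def toL2 (a : ℝ) : HHalf a →L[ℝ] L2 a :=
  (WithLp.fstL 2 ℝ (L2 a) (Lp E3 2 (slobMeasure a))).comp (halfGraph a).subtypeL

/-- The embedding `L²(∂B; ℝ³) → H^{-1/2}(∂B; ℝ³)`: the density `f` acts on `φ` by
`∫ f · φ dσ`. -/
noncomputable def ofL2 {a : ℝ} (f : L2 a) : HNegHalf a :=
  (innerSL ℝ f).comp (toL2 a)

/-- The stokeslet `G(r) = (8πη)⁻¹ (Id / |r| + r ⊗ r / |r|³)`, applied to a vector `v`. -/
noncomputable def stokeslet (η : ℝ) (r v : E3) : E3 :=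
  (8 * Real.pi * η)⁻¹ • (‖r‖⁻¹ • v + (‖r‖ ^ 3)⁻¹ • (inner ℝ r v • r))

/-- The set `S_N` of centres of `N` balls of radius `a` with pairwise disjoint closures. -/
def configSet (N : ℕ) (a : ℝ) : Set (Fin N → E3) :=
  {x | ∀ i j, i < j → 2 * a < ‖x i - x j‖}

/-- `T` is the single-layer (Neumann-to-Dirichlet) operator `T_x : H^{-1/2}_N → H^{1/2}_N`,
`(T_x f)_i (r) = ∑ j, ∫ G(x_i - x_j + r - s) f_j(s) dσ(s)`.
The integrals are ordinary ones if the `f_j` are in `L²`, a dense subspace of `H^{-1/2}`, and this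
determines `T`, which is continuous. For `j ≠ i` the kernel is smooth, and the `j`-th term is the
duality pairing of `f_j ∈ H^{-1/2}` with `s ↦ G(x_i - x_j + r - s)`; since `G(z)` is a symmetric
matrix, the component of this pairing along `v` is the value of the functional `f_j` at
`s ↦ G(x_i - x_j + r - s) v`. -/
structure IsSingleLayer {N : ℕ} (η a : ℝ) (x : Fin N → E3)
    (T : (Fin N → HNegHalf a) →L[ℝ] (Fin N → HHalf a)) : Prop where
  density : ∀ f : Fin N → L2 a, ∀ i : Fin N, ∀ᵐ r ∂(surf a),
    (∀ j, Integrable (fun s => stokeslet η (x i - x j + r - s) (f j s)) (surf a)) ∧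
    toL2 a (T (fun j => ofL2 (f j)) i) r =
      ∑ j, ∫ s, stokeslet η (x i - x j + r - s) (f j s) ∂(surf a)
  pairing : ∀ i j : Fin N, i ≠ j → ∀ f : HNegHalf a, ∀ᵐ r ∂(surf a), ∀ v : E3,
    ∃ φ : HHalf a, (toL2 a φ =ᵐ[surf a] fun s => stokeslet η (x i - x j + r - s) v) ∧
      inner ℝ (toL2 a (T (Pi.single j f) i) r) v = f φ

end Stokes

/-!
The space `H^{1/2}` is realized as a closed subspace of a Hilbert space, and its embedding in `L²`
is injective. Hence `L²` is dense in the dual `H^{-1/2}`, and the integral formula on `L²`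
determines a bounded operator (`IsSingleLayer.unique`). It remains to construct, near every
configuration, one family of operators with the required properties that is analytic in the
configuration: since the configurations form an open set, uniqueness transfers the analyticity to
any family of single-layer operators. The operator is a matrix of blocks. The diagonal blocks do
not depend on the configuration, and the off-diagonal ones depend on `x_i - x_j` only.

*Diagonal blocks.* Layer potentials and the theory of Sobolev spaces on surfaces are avoided by
factoring the kernel through `L²(ℝ × ℝ³)`, the space of functions of a scale `t = exp τ` and a
centre `x`. If `φ` is the tent `α ↦ (1 - |α|)⁺`, then
`∫ φ((r - x) / t) φ((s - x) / t) t^{-4-p} dτ dx` is invariant under translations and rotations and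
homogeneous of degree `-1 - p`, so it is a positive multiple of `|r - s|^{-1-p}`. The case `p = 0`
gives `|z|⁻¹`. For `z_i z_j |z|⁻³`, with `z = r - s`, take `p = 2` and write
`z = (r - x) - (s - x)`, which turns the kernel into a sum of four such integrals with profiles
`φ`, `α_i φ` and `α_i α_j φ` (`profKernel_coord`). Each of these kernels belongs to an operator
`A_φ M A_χᵀ`, where `A_φ g = ∫ t⁻² φ((· - x) / t) g(τ, x) dτ dx` and `M` is a constant matrix. So
only the boundedness of `A_φ : L²(ℝ × ℝ³) → H^{1/2}` is needed (`IsProfile.exists_avgCLM`), because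
the transpose is then bounded on `H^{-1/2}`. Both parts of the norm are estimated by the Schur test
(`lintegral_schur`), from the facts that a ball of radius `t` has surface measure `O(t²)` and that
the profiles are Lipschitz.

*Off-diagonal blocks.* If `c` is analytic near a translate of the closed ball `K` of radius `a`,
then `y ↦ (r ↦ c (y + r))` is analytic as a map into the continuous functions on `K`
(`analyticAt_superpose`). The same holds for the derivative of `c`, and both restrict to the sphere
by bounded linear maps, the second giving the differences `c (y + r) - c (y + s)` as integrals over
segments. After projecting orthogonally on `H^{1/2}`, the restriction of `c (y + ·)` to the sphere
is analytic in `y` with values in `H^{1/2}` (`exists_analytic_trace`). This is applied first to the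
stokeslet as a function of the source point, which gives a field with values in the operators from
`ℝ³` to `H^{1/2}`; pairing it with functionals gives a field with values in the operators from
`H^{-1/2}` to `ℝ³`, analytic in the target point, and a second application to that field gives the
blocks, analytic in the operator norm (`exists_interaction`).
-/

namespace Stokes

/-! ### Superposition operators -/

section Superposition

variable {K E V : Type*} [TopologicalSpace K] [NormedAddCommGroup E] [NormedAddCommGroup V]

/-- The superposition `k ↦ f (y + j k)` as a continuous map; it is `0` if that function is not
continuous. -/
noncomputable def superpose (f : E → V) (j : C(K, E)) (y : E) : C(K, V) :=
  open Classical in if h : Continuous fun k => f (y + j k) then ⟨_, h⟩ else 0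

theorem superpose_eq_of_forall {f : E → V} {j : C(K, E)} {y : E} {F : C(K, V)}
    (hF : ∀ k, F k = f (y + j k)) : superpose f j y = F := by
  have h : Continuous fun k => f (y + j k) := by
    have := F.continuous
    convert this using 1
    ext k; exact (hF k).symm
  unfold superpose
  rw [dif_pos h]
  ext k; exact (hF k).symm

theorem superpose_apply {f : E → V} {j : C(K, E)} {y : E}
    (h : ∀ k, ContinuousAt f (y + j k)) (k : K) : superpose f j y k = f (y + j k) := by
  have h' : Continuous fun k => f (y + j k) := continuous_iff_continuousAt.2 fun k =>
    ContinuousAt.comp (f := fun k => y + j k) (h k) (by fun_prop)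
  unfold superpose
  rw [dif_pos h']
  rfl

variable [CompactSpace K] [NormedSpace ℝ E] [NormedSpace ℝ V]

/-- The multilinear map on continuous functions obtained by applying `m` pointwise. -/
noncomputable def pointwiseMultilinear (K : Type*) [TopologicalSpace K] [CompactSpace K] {n : ℕ}
    (m : ContinuousMultilinearMap ℝ (fun _ : Fin n => E) V) :
    ContinuousMultilinearMap ℝ (fun _ : Fin n => C(K, E)) C(K, V) :=
  MultilinearMap.mkContinuous
    { toFun := fun φ => ⟨fun k => m fun i => φ i k,
        m.cont.comp (continuous_pi fun i => (φ i).continuous)⟩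
      map_update_add' := by
        intro _ φ i x y
        ext k
        have h : ∀ z : C(K, E), (fun l => (Function.update φ i z) l k)
            = Function.update (fun l => φ l k) i (z k) := by
          intro z; ext l; by_cases hl : l = i
          · subst hl; simp
          · simp [hl]
        simp [h]
      map_update_smul' := by
        intro _ φ i c x
        ext k
        have h : ∀ z : C(K, E), (fun l => (Function.update φ i z) l k)
            = Function.update (fun l => φ l k) i (z k) := by
          intro z; ext l; by_cases hl : l = i
          · subst hl; simp
          · simp [hl]
        simp [h] }
    ‖m‖ (by
      intro φ
      refine (ContinuousMap.norm_le _ (by positivity)).2 fun k => ?_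
      refine (m.le_opNorm _).trans ?_
      gcongr with i
      exact (φ i).norm_coe_le_norm k)

/-- The power series on `C(K, E)` obtained by applying a power series on `E` pointwise. -/
noncomputable def pointwiseSeries (K : Type*) [TopologicalSpace K] [CompactSpace K]
    (p : FormalMultilinearSeries ℝ E V) : FormalMultilinearSeries ℝ C(K, E) C(K, V) :=
  fun n => pointwiseMultilinear K (p n)

theorem radius_le_radius_pointwiseSeries (p : FormalMultilinearSeries ℝ E V) :
    p.radius ≤ (pointwiseSeries K p).radius := by
  refine FormalMultilinearSeries.radius_le_of_le fun {n} => ?_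
  unfold pointwiseSeries pointwiseMultilinear
  exact MultilinearMap.mkContinuous_norm_le _ (norm_nonneg _) _

theorem pointwiseSeries_sum_apply [CompleteSpace V] (p : FormalMultilinearSeries ℝ E V)
    {φ : C(K, E)} (hφ : ENNReal.ofReal ‖φ‖ < p.radius) (k : K) :
    (pointwiseSeries K p).sum φ k = p.sum (φ k) := by
  have hs : Summable fun n => pointwiseSeries K p n fun _ => φ := by
    refine (pointwiseSeries K p).summable (x := φ) ?_
    rw [Metric.mem_eball, edist_zero_right, ← ofReal_norm]
    exact hφ.trans_le (radius_le_radius_pointwiseSeries p)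
  have := (ContinuousMap.evalCLM ℝ (M := V) k).map_tsum hs
  exact this

/-- Multiplication by a scalar function of a compact space. -/
noncomputable def mulCLM (θ : C(K, ℝ)) : C(K, V) →L[ℝ] C(K, V) :=
  LinearMap.mkContinuous
    { toFun := fun g => ⟨fun k => θ k • g k, by fun_prop⟩
      map_add' := by intro g h; ext k; simp
      map_smul' := by intro c g; ext k; exact smul_comm _ _ _ } ‖θ‖ (by
      intro g
      refine (ContinuousMap.norm_le _ (by positivity)).2 fun k => ?_
      refine (norm_smul_le _ _).trans ?_
      gcongr
      · exact θ.norm_coe_le_norm k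
      · exact g.norm_coe_le_norm k)

theorem mulCLM_apply (θ : C(K, ℝ)) (g : C(K, V)) (k : K) : mulCLM θ g k = θ k • g k := rfl

/-- The superposition operator of a function analytic near the compact set `y₀ + j K` is analytic
at `y₀`. If `j K` lies in a single ball of convergence, then it is given by the pointwise power
series; in general these local expressions are glued by a partition of unity on `K`. -/
theorem analyticAt_superpose [T2Space K] [CompleteSpace V] {f : E → V} {j : C(K, E)} {y₀ : E}
    (hf : ∀ k, AnalyticAt ℝ f (y₀ + j k)) : AnalyticAt ℝ (superpose f j) y₀ := by
  have h1 : ∀ k₀ : K, ∃ p : FormalMultilinearSeries ℝ E V, ∃ r : ℝ, 0 < r ∧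
      HasFPowerSeriesOnBall f p (y₀ + j k₀) (ENNReal.ofReal (2 * r)) := by
    intro k₀
    obtain ⟨p, R, hp⟩ := hf k₀
    obtain ⟨r, hr0, hr⟩ : ∃ r : ℝ, 0 < r ∧ ENNReal.ofReal (2 * r) ≤ R := by
      obtain ⟨q, hq0, hq⟩ := ENNReal.lt_iff_exists_nnreal_btwn.1 hp.r_pos
      refine ⟨q / 2, by simpa using hq0, ?_⟩
      rw [mul_div_cancel₀ _ two_ne_zero, ENNReal.ofReal_coe_nnreal]
      exact hq.le
    exact ⟨p, r, hr0, hp.mono (by simpa using hr0) hr⟩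
  choose p r hr hp using h1
  let U : K → Set K := fun k₀ => {k | ‖j k - j k₀‖ < r k₀}
  have hU : ∀ k₀, IsOpen (U k₀) := fun k₀ => isOpen_lt (by fun_prop) (by fun_prop)
  obtain ⟨s, hs⟩ := isCompact_univ.elim_finite_subcover U hU
    (fun k _ => Set.mem_iUnion.2 ⟨k, by
      change ‖j k - j k‖ < r k
      rw [sub_self, norm_zero]; exact hr k⟩)
  obtain ⟨θ, hθ⟩ := PartitionOfUnity.exists_isSubordinate isClosed_univ (fun i : s => U i)
    (fun i => hU i) (by simpa [Set.iUnion_subtype] using hs)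
  -- `j - j k₀`, radially cut off at distance `r k₀`, so that it is continuous on all of `K`, small
  -- enough for the power series at `y₀ + j k₀`, and unchanged where `θ k₀` does not vanish
  let c : K → C(K, E) := fun k₀ =>
    ⟨fun k => (max 1 (‖j k - j k₀‖ / r k₀))⁻¹ • (j k - j k₀), by
      refine Continuous.smul (Continuous.inv₀ (by fun_prop) fun k => ?_) (by fun_prop)
      positivity⟩
  have hc : ∀ k₀ k, ‖c k₀ k‖ ≤ r k₀ := by
    intro k₀ k
    change ‖(max 1 (‖j k - j k₀‖ / r k₀))⁻¹ • (j k - j k₀)‖ ≤ _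
    have := hr k₀
    have h0 : (0 : ℝ) < max 1 (‖j k - j k₀‖ / r k₀) := by positivity
    rw [norm_smul, norm_inv, Real.norm_of_nonneg h0.le, inv_mul_le_iff₀ h0, mul_comm,
      ← div_le_iff₀' this]
    exact le_max_right _ _
  have hcU : ∀ k₀ k, k ∈ U k₀ → c k₀ k = j k - j k₀ := by
    intro k₀ k hk
    change (max 1 (‖j k - j k₀‖ / r k₀))⁻¹ • (j k - j k₀) = _
    rw [max_eq_left]
    · simp
    · rw [div_le_one (hr k₀)]; exact le_of_lt hk
  let φ : K → E → C(K, E) := fun k₀ y => ContinuousMap.const K (y - y₀) + c k₀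
  have hφn : ∀ k₀ y, ‖φ k₀ y‖ ≤ ‖y - y₀‖ + r k₀ := by
    intro k₀ y
    refine (ContinuousMap.norm_le _ (by have := hr k₀; positivity)).2 fun k => ?_
    refine (norm_add_le _ _).trans ?_
    gcongr
    · exact le_refl _
    · exact hc k₀ k
  have hφa : ∀ k₀, AnalyticAt ℝ (φ k₀) y₀ := by
    intro k₀
    have : AnalyticAt ℝ (fun y : E => ContinuousLinearMap.const ℝ K (M := E) (y - y₀)) y₀ := by
      exact ((ContinuousLinearMap.const ℝ K (M := E)).analyticAt _).comp
        (f := fun y : E => y - y₀) (by fun_prop)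
    exact this.add analyticAt_const
  have hball : ∀ k₀ y, ‖y - y₀‖ < r k₀ →
      ENNReal.ofReal ‖φ k₀ y‖ < ENNReal.ofReal (2 * r k₀) := by
    intro k₀ y hy
    rw [ENNReal.ofReal_lt_ofReal_iff (by have := hr k₀; positivity)]
    linarith [hφn k₀ y]
  let Φ : K → C(K, E) → C(K, V) := fun k₀ => (pointwiseSeries K (p k₀)).sum
  have hΦa : ∀ k₀, AnalyticAt ℝ (fun y => Φ k₀ (φ k₀ y)) y₀ := by
    intro k₀
    have hpos : 0 < (pointwiseSeries K (p k₀)).radius :=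
      ((hp k₀).r_pos.trans_le (hp k₀).r_le).trans_le (radius_le_radius_pointwiseSeries _)
    have := (pointwiseSeries K (p k₀)).hasFPowerSeriesOnBall hpos
    refine AnalyticAt.comp (g := Φ k₀) (f := φ k₀) ?_ (hφa k₀)
    refine this.analyticAt_of_mem ?_
    rw [Metric.mem_eball, edist_zero_right, ← ofReal_norm]
    refine ((hball k₀ y₀ (by simpa using hr k₀)).trans_le (hp k₀).r_le).trans_le
      (radius_le_radius_pointwiseSeries _)
  let F : E → C(K, V) := fun y => ∑ i : s, mulCLM (θ i) (Φ i (φ i y))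
  have hF : AnalyticAt ℝ F y₀ := by
    refine Finset.analyticAt_fun_sum _ fun i _ => ?_
    exact ((mulCLM (θ i)).analyticAt _).comp (hΦa i)
  refine hF.congr ?_
  have hev : ∀ᶠ y in nhds y₀, ∀ i : s, ‖y - y₀‖ < r i := by
    rw [Filter.eventually_all]
    intro i
    have : Filter.Tendsto (fun y => ‖y - y₀‖) (nhds y₀) (nhds 0) := by
      have : Continuous fun y => ‖y - y₀‖ := by fun_prop
      simpa using this.tendsto y₀
    exact this.eventually_lt_const (hr i)
  filter_upwards [hev] with y hy
  refine (superpose_eq_of_forall fun k => ?_).symm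
  have hterm : ∀ i : s, mulCLM (θ i) (Φ i (φ i y)) k = θ i k • f (y + j k) := by
    intro i
    rw [mulCLM_apply]
    by_cases h0 : θ i k = 0
    · simp [h0]
    have hk : k ∈ U i := hθ i (subset_tsupport _ h0)
    have hb := hball i y (hy i)
    rw [show Φ i (φ i y) k = (p i).sum (φ i y k) from
      pointwiseSeries_sum_apply _ (hb.trans_le (hp i).r_le) k]
    have hmem : φ i y k ∈ Metric.eball (0 : E) (ENNReal.ofReal (2 * r i)) := by
      rw [Metric.mem_eball, edist_zero_right, ← ofReal_norm]
      refine lt_of_le_of_lt (ENNReal.ofReal_le_ofReal ?_) hb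
      exact (φ i y).norm_coe_le_norm k
    rw [← (hp i).sum hmem]
    congr 2
    change y₀ + j i + ((y - y₀) + c i k) = y + j k
    rw [hcU i k hk]; abel
  have h1 := θ.sum_eq_one (Set.mem_univ k)
  rw [finsum_eq_sum_of_fintype] at h1
  change (∑ i : s, mulCLM (θ i) (Φ i (φ i y))) k = _
  rw [ContinuousMap.coe_sum, Finset.sum_apply, Finset.sum_congr rfl fun i _ => hterm i,
    ← Finset.sum_smul, h1, one_smul]

end Superposition

/-! ### The Schur test -/

open ENNReal in
/-- The Cauchy–Schwarz inequality with a weight. -/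
theorem lintegral_mul_sq_le {X : Type*} [MeasurableSpace X] {m : Measure X} {M w g : X → ℝ≥0∞}
    (hM : AEMeasurable M m) (hw : AEMeasurable w m) (hg : AEMeasurable g m)
    (hw0 : ∀ x, w x ≠ 0) (hwt : ∀ x, w x ≠ ∞) :
    (∫⁻ x, M x * g x ∂m) ^ 2 ≤ (∫⁻ x, M x * w x ∂m) * ∫⁻ x, M x * (w x)⁻¹ * g x ^ 2 ∂m := by
  have h := ENNReal.lintegral_mul_le_Lp_mul_Lq m Real.HolderConjugate.two_two
    (f := fun x => (M x * w x) ^ (1 / 2 : ℝ)) (g := fun x => (M x * (w x)⁻¹) ^ (1 / 2 : ℝ) * g x)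
    ((hM.mul hw).pow_const _) (((hM.mul hw.inv).pow_const _).mul hg)
  have e1 : ∀ x, ((fun x => (M x * w x) ^ (1 / 2 : ℝ)) *
      fun x => (M x * (w x)⁻¹) ^ (1 / 2 : ℝ) * g x) x = M x * g x := by
    intro x
    simp only [Pi.mul_apply]
    rw [← mul_assoc, ← ENNReal.mul_rpow_of_nonneg _ _ (by norm_num)]
    have : M x * w x * (M x * (w x)⁻¹) = M x ^ (2 : ℝ) := by
      rw [ENNReal.rpow_two, mul_mul_mul_comm, ENNReal.mul_inv_cancel (hw0 x) (hwt x), mul_one, sq]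
    rw [this, ← ENNReal.rpow_mul]; norm_num
  have e2 : ∀ x, ((M x * w x) ^ (1 / 2 : ℝ)) ^ (2 : ℝ) = M x * w x := by
    intro x; rw [← ENNReal.rpow_mul]; norm_num
  have e3 : ∀ x, ((M x * (w x)⁻¹) ^ (1 / 2 : ℝ) * g x) ^ (2 : ℝ) = M x * (w x)⁻¹ * g x ^ 2 := by
    intro x
    rw [ENNReal.mul_rpow_of_nonneg _ _ (by norm_num), ← ENNReal.rpow_mul, ENNReal.rpow_two]
    norm_num
  simp only [e1, e2, e3] at h
  calc (∫⁻ x, M x * g x ∂m) ^ 2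
      ≤ ((∫⁻ x, M x * w x ∂m) ^ (1 / 2 : ℝ) *
          (∫⁻ x, M x * (w x)⁻¹ * g x ^ 2 ∂m) ^ (1 / 2 : ℝ)) ^ 2 := by gcongr
    _ = _ := by
      rw [← ENNReal.mul_rpow_of_nonneg _ _ (by norm_num), ← ENNReal.rpow_two, ← ENNReal.rpow_mul]
      norm_num

open ENNReal in
/-- The Schur test with weights `w` and `p`, for a nonnegative kernel `M`. -/
theorem lintegral_schur {X Y : Type*} [MeasurableSpace X] [MeasurableSpace Y]
    {m : Measure X} {ν : Measure Y} [SFinite m] [SFinite ν] {M : Y → X → ℝ≥0∞}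
    (hM : Measurable (Function.uncurry M)) {w : X → ℝ≥0∞} (hw : Measurable w)
    (hw0 : ∀ x, w x ≠ 0) (hwt : ∀ x, w x ≠ ∞) {p : Y → ℝ≥0∞} (hp : Measurable p) {C : ℝ≥0∞}
    (h1 : ∀ y, ∫⁻ x, M y x * w x ∂m ≤ p y) (h2 : ∀ x, ∫⁻ y, M y x * p y ∂ν ≤ C * w x)
    {g : X → ℝ≥0∞} (hg : AEMeasurable g m) :
    ∫⁻ y, (∫⁻ x, M y x * g x ∂m) ^ 2 ∂ν ≤ C * ∫⁻ x, g x ^ 2 ∂m := by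
  have hMy : ∀ y, Measurable (M y) := fun y => hM.comp measurable_prodMk_left
  calc ∫⁻ y, (∫⁻ x, M y x * g x ∂m) ^ 2 ∂ν
      ≤ ∫⁻ y, ∫⁻ x, p y * (M y x * (w x)⁻¹ * g x ^ 2) ∂m ∂ν := by
        refine lintegral_mono fun y => ?_
        refine (lintegral_mul_sq_le (hMy y).aemeasurable hw.aemeasurable hg hw0 hwt).trans ?_
        rw [lintegral_const_mul'' (f := fun x => M y x * (w x)⁻¹ * g x ^ 2) _
          (((hMy y).mul hw.inv).aemeasurable.mul (hg.pow_const 2))]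
        gcongr
        exact h1 y
    _ = ∫⁻ x, ∫⁻ y, p y * (M y x * (w x)⁻¹ * g x ^ 2) ∂ν ∂m := by
        refine lintegral_lintegral_swap ?_
        have e1 : AEMeasurable (fun z : Y × X => g z.2) (ν.prod m) :=
          hg.comp_quasiMeasurePreserving Measure.quasiMeasurePreserving_snd
        exact (hp.comp measurable_fst).aemeasurable.mul
          ((hM.mul (hw.comp measurable_snd).inv).aemeasurable.mul (e1.pow_const 2))
    _ ≤ ∫⁻ x, C * g x ^ 2 ∂m := by
        refine lintegral_mono fun x => ?_
        have hMx : Measurable fun y => M y x := hM.comp measurable_prodMk_right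
        calc ∫⁻ y, p y * (M y x * (w x)⁻¹ * g x ^ 2) ∂ν
            = ∫⁻ y, (M y x * p y) * ((w x)⁻¹ * g x ^ 2) ∂ν := by
              refine lintegral_congr fun y => ?_; ring
          _ = (∫⁻ y, M y x * p y ∂ν) * ((w x)⁻¹ * g x ^ 2) := lintegral_mul_const _ (hMx.mul hp)
          _ ≤ C * w x * ((w x)⁻¹ * g x ^ 2) := by gcongr; exact h2 x
          _ = C * g x ^ 2 := by
              rw [mul_assoc, ← mul_assoc (w x), ENNReal.mul_inv_cancel (hw0 x) (hwt x), one_mul]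
    _ = C * ∫⁻ x, g x ^ 2 ∂m := lintegral_const_mul'' _ (hg.pow_const 2)

/-! ### The surface measure -/

open ENNReal Pointwise in
/-- A cap of radius `t` of the unit sphere has area `O(t²)`: the cone over it without its smaller
copy of ratio `1 - t` lies in a ball of radius `2t`. -/
theorem toSphere_le {S : Set (Metric.sphere (0 : E3) 1)} (hS : MeasurableSet S) {x : E3} {t : ℝ}
    (ht : 0 < t) (hSx : ∀ ω ∈ S, (ω : E3) ∈ Metric.ball x t) :
    (volume : Measure E3).toSphere S ≤
      ENNReal.ofReal (t ^ 2) * (24 * volume (Metric.ball (0 : E3) 1)) := by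
  have hdim : Module.finrank ℝ E3 = 3 := by simp
  rw [Measure.toSphere_apply' _ hS, hdim]
  set cone : Set E3 := Set.Ioo (0 : ℝ) 1 • ((↑) '' S) with hcone
  set b := volume (Metric.ball (0 : E3) 1) with hb
  have hcb : cone ⊆ Metric.ball 0 1 := by
    rintro _ ⟨l, hl, _, ⟨ω, hω, rfl⟩, rfl⟩
    have : ‖(ω : E3)‖ = 1 := by simp
    rw [mem_ball_zero_iff]
    simp only [norm_smul, this, mul_one, Real.norm_eq_abs]
    rw [abs_of_pos hl.1]; exact hl.2
  have hbt : b ≠ ∞ := measure_ball_lt_top.ne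
  have hct : volume cone ≠ ∞ := ((measure_mono hcb).trans_lt measure_ball_lt_top).ne
  rcases le_or_gt 1 t with h1 | h1
  · calc ((3 : ℕ) : ℝ≥0∞) * volume cone ≤ 1 * (24 * b) := by
          rw [one_mul]; gcongr
          · norm_num
          · exact measure_mono hcb
      _ ≤ _ := by
          gcongr
          rw [ENNReal.one_le_ofReal]; nlinarith
  have hsub : cone ⊆ Metric.ball x (2 * t) ∪ (1 - t) • cone := by
    rintro _ ⟨l, hl, _, ⟨ω, hω, rfl⟩, rfl⟩
    have hω1 : ‖(ω : E3)‖ = 1 := by simp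
    rcases lt_or_ge l (1 - t) with h | h
    · right
      refine ⟨(l / (1 - t)) • (ω : E3), ⟨l / (1 - t), ⟨by have := hl.1; positivity, ?_⟩, ω,
        ⟨ω, hω, rfl⟩, rfl⟩, ?_⟩
      · rw [div_lt_one (by linarith)]; exact h
      · simp only [smul_smul]
        rw [mul_div_cancel₀ _ (by linarith)]
    · left
      have h2 := hSx ω hω
      rw [Metric.mem_ball, dist_eq_norm] at h2 ⊢
      calc ‖l • (ω : E3) - x‖ = ‖(l - 1) • (ω : E3) + (ω - x)‖ := by congr 1; module
        _ ≤ ‖(l - 1) • (ω : E3)‖ + ‖(ω : E3) - x‖ := norm_add_le _ _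
        _ < t + t := by
            rw [norm_smul, hω1, mul_one, Real.norm_eq_abs, abs_of_neg (by linarith [hl.2])]
            linarith
        _ = 2 * t := by ring
  have hv : volume cone ≤ ENNReal.ofReal ((2 * t) ^ 3) * b
      + ENNReal.ofReal ((1 - t) ^ 3) * volume cone := by
    refine (measure_mono hsub).trans ((measure_union_le _ _).trans ?_)
    rw [Measure.addHaar_ball _ _ (by positivity), Measure.addHaar_smul, hdim,
      abs_of_pos (by apply pow_pos; linarith)]
  have hreal : (volume cone).toReal ≤ 8 * t ^ 2 * b.toReal := by
    have h2 := ENNReal.toReal_mono (by finiteness) hv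
    rw [ENNReal.toReal_add (by finiteness) (by finiteness), ENNReal.toReal_mul, ENNReal.toReal_mul,
      ENNReal.toReal_ofReal (by positivity), ENNReal.toReal_ofReal
        (by apply pow_nonneg; linarith)] at h2
    have hv0 : 0 ≤ (volume cone).toReal := ENNReal.toReal_nonneg
    have h3 : t * (volume cone).toReal ≤ t * (8 * t ^ 2 * b.toReal) := by
      have : t ≤ 1 - (1 - t) ^ 3 := by nlinarith [mul_pos ht (sub_pos.2 h1)]
      nlinarith [mul_le_mul_of_nonneg_right this hv0]
    exact le_of_mul_le_mul_left h3 ht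
  have : volume cone ≤ ENNReal.ofReal (t ^ 2) * (8 * b) := by
    rw [← ENNReal.toReal_le_toReal hct (by finiteness), ENNReal.toReal_mul, ENNReal.toReal_mul,
      ENNReal.toReal_ofReal (by positivity)]
    refine hreal.trans (le_of_eq ?_)
    simp; ring
  calc ((3 : ℕ) : ℝ≥0∞) * volume cone ≤ 3 * (ENNReal.ofReal (t ^ 2) * (8 * b)) := by
        gcongr; norm_num
    _ = _ := by
        rw [show (24 : ℝ≥0∞) = 3 * 8 by norm_num]; ring

/-- The density constant of the surface measure: `surf a (ball x t) ≤ surfC * t ^ 2`. -/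
noncomputable def surfC : ENNReal := 24 * volume (Metric.ball (0 : E3) 1)

theorem surfC_ne_top : surfC ≠ ⊤ := by
  unfold surfC; finiteness

theorem measurable_smul_coe_sphere (a : ℝ) :
    Measurable fun ω : Metric.sphere (0 : E3) 1 => a • (ω : E3) := by fun_prop

theorem surf_ball_le {a : ℝ} (ha : 0 < a) (x : E3) {t : ℝ} (ht : 0 < t) :
    surf a (Metric.ball x t) ≤ ENNReal.ofReal (t ^ 2) * surfC := by
  unfold surf
  rw [Measure.smul_apply, Measure.map_apply (measurable_smul_coe_sphere a)
    Metric.isOpen_ball.measurableSet]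
  have h := toSphere_le (S := (fun ω : Metric.sphere (0 : E3) 1 => a • (ω : E3)) ⁻¹'
    Metric.ball x t) (measurable_smul_coe_sphere a Metric.isOpen_ball.measurableSet)
    (x := a⁻¹ • x) (t := t / a) (by positivity) (by
      intro ω hω
      rw [Set.mem_preimage, Metric.mem_ball, dist_eq_norm] at hω
      rw [Metric.mem_ball, dist_eq_norm, lt_div_iff₀ ha, mul_comm]
      refine lt_of_eq_of_lt ?_ hω
      calc a * ‖(ω : E3) - a⁻¹ • x‖ = ‖a • ((ω : E3) - a⁻¹ • x)‖ := by
            rw [norm_smul, Real.norm_of_nonneg ha.le]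
        _ = _ := by rw [smul_sub, smul_smul, mul_inv_cancel₀ ha.ne', one_smul])
  rw [ENNReal.smul_def, smul_eq_mul]
  change ENNReal.ofReal (a ^ 2) * _ ≤ _
  refine (mul_le_mul_right h _).trans (le_of_eq ?_)
  rw [← mul_assoc, ← ENNReal.ofReal_mul (by positivity)]
  congr 2
  field_simp

theorem ae_surf_norm_le {a : ℝ} (ha : 0 < a) : ∀ᵐ r ∂(surf a), ‖r‖ ≤ a := by
  unfold surf
  refine Measure.ae_smul_measure ?_ _
  rw [ae_map_iff (measurable_smul_coe_sphere a).aemeasurable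
    (measurableSet_le measurable_norm measurable_const)]
  refine Filter.Eventually.of_forall fun ω => ?_
  have : ‖(ω : E3)‖ = 1 := by simp
  rw [norm_smul, this, mul_one, Real.norm_of_nonneg ha.le]

/-! ### Integrals over scales -/

/-- The integral of `exp (-|τ| / 2)` over the line. -/
noncomputable def scaleC : ENNReal := ∫⁻ τ : ℝ, ENNReal.ofReal (Real.exp (-|τ| / 2))

theorem scaleC_ne_top : scaleC ≠ ⊤ := by
  have h : Integrable (fun τ : ℝ => Real.exp (-|τ| / 2)) := by
    rw [← integrableOn_univ, ← Set.Iic_union_Ioi (a := (0 : ℝ))]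
    refine IntegrableOn.union ?_ ?_
    · refine (integrableOn_exp_mul_Iic (a := 1 / 2) (by norm_num) 0).congr_fun (fun τ hτ => ?_)
        measurableSet_Iic
      simp only [abs_of_nonpos (Set.mem_Iic.1 hτ)]
      congr 1; ring
    · refine (integrableOn_exp_mul_Ioi (a := -1 / 2) (by norm_num) 0).congr_fun (fun τ hτ => ?_)
        measurableSet_Ioi
      simp only [abs_of_pos (Set.mem_Ioi.1 hτ)]
      congr 1; ring
  exact h.lintegral_lt_top.ne

theorem exp_half_mul_min (l τ : ℝ) :
    Real.exp (τ / 2) * min 1 (Real.exp (l - τ)) = Real.exp (l / 2) * Real.exp (-|τ - l| / 2) := by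
  rw [← Real.exp_zero, ← Real.exp_monotone.map_min, ← Real.exp_add, ← Real.exp_add]
  congr 1
  rcases le_total τ l with h | h
  · rw [min_eq_left (by linarith), abs_of_nonpos (by linarith)]; ring
  · rw [min_eq_right (by linarith), abs_of_nonneg (by linarith)]; ring

theorem lintegral_exp_half_mul_min (l : ℝ) :
    ∫⁻ τ : ℝ, ENNReal.ofReal (Real.exp (τ / 2) * min 1 (Real.exp (l - τ)))
      = ENNReal.ofReal (Real.exp (l / 2)) * scaleC := by
  simp_rw [exp_half_mul_min, ENNReal.ofReal_mul (Real.exp_pos _).le]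
  rw [lintegral_const_mul _ (by fun_prop), scaleC,
    lintegral_sub_right_eq_self (fun τ : ℝ => ENNReal.ofReal (Real.exp (-|τ| / 2)))]

/-! ### Boundedness of the localized averages -/

/-- The kernel `t⁻²` on `|r - x| < t`, where `t = exp τ` is the scale and `q = (τ, x)`. -/
noncomputable def bump (r : E3) (q : ℝ × E3) : ENNReal :=
  if ‖r - q.2‖ < Real.exp q.1 then ENNReal.ofReal (Real.exp (-2 * q.1)) else 0

@[fun_prop]
theorem Measurable.bump {α : Type*} [MeasurableSpace α] {f : α → E3} {g : α → ℝ × E3}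
    (hf : Measurable f) (hg : Measurable g) : Measurable fun x => bump (f x) (g x) := by
  unfold Stokes.bump
  exact Measurable.ite (measurableSet_lt (by fun_prop) (by fun_prop)) (by fun_prop)
    measurable_const

theorem lintegral_bump_mul (r : E3) {h : ℝ → ENNReal} (hh : Measurable h) :
    ∫⁻ q, bump r q * h q.1 =
      (∫⁻ τ, ENNReal.ofReal (Real.exp τ) * h τ) * volume (Metric.ball (0 : E3) 1) := by
  rw [Measure.volume_eq_prod, lintegral_prod _
    (by fun_prop),
    ← lintegral_mul_const _ (by fun_prop)]
  refine lintegral_congr fun τ => ?_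
  have e : ∀ x : E3, bump r (τ, x) * h τ =
      (Metric.ball r (Real.exp τ)).indicator
        (fun _ => ENNReal.ofReal (Real.exp (-2 * τ)) * h τ) x := by
    intro x
    by_cases hx : ‖r - x‖ < Real.exp τ
    · rw [Set.indicator_of_mem (by rwa [Metric.mem_ball, dist_comm, dist_eq_norm])]
      simp [bump, hx]
    · rw [Set.indicator_of_notMem (by rwa [Metric.mem_ball, dist_comm, dist_eq_norm])]
      simp [bump, hx]
  simp_rw [e]
  rw [lintegral_indicator_const Metric.isOpen_ball.measurableSet,
    Measure.addHaar_ball _ _ (Real.exp_pos _).le]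
  have h3 : Module.finrank ℝ E3 = 3 := by simp
  have : ENNReal.ofReal (Real.exp (-2 * τ)) * ENNReal.ofReal (Real.exp τ ^ 3)
      = ENNReal.ofReal (Real.exp τ) := by
    rw [← ENNReal.ofReal_mul (Real.exp_pos _).le, ← Real.exp_nat_mul, ← Real.exp_add]
    congr 2; push_cast; ring
  rw [h3, ← this]; ring

theorem lintegral_bump_surf {a : ℝ} (q : ℝ × E3) (c : ENNReal) :
    ∫⁻ r, bump r q * c ∂(surf a) =
      ENNReal.ofReal (Real.exp (-2 * q.1)) * c * surf a (Metric.ball q.2 (Real.exp q.1)) := by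
  have e : ∀ r : E3, bump r q * c = (Metric.ball q.2 (Real.exp q.1)).indicator
        (fun _ => ENNReal.ofReal (Real.exp (-2 * q.1)) * c) r := by
    intro x
    by_cases hx : ‖x - q.2‖ < Real.exp q.1
    · rw [Set.indicator_of_mem (by rwa [Metric.mem_ball, dist_eq_norm])]
      simp [bump, hx]
    · rw [Set.indicator_of_notMem (by rwa [Metric.mem_ball, dist_eq_norm])]
      simp [bump, hx]
  simp_rw [e]
  rw [lintegral_indicator_const Metric.isOpen_ball.measurableSet]

theorem exp_neg_two_mul_surf_ball_le {a : ℝ} (ha : 0 < a) (q : ℝ × E3) :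
    ENNReal.ofReal (Real.exp (-2 * q.1)) * surf a (Metric.ball q.2 (Real.exp q.1)) ≤ surfC := by
  refine (mul_le_mul_right (surf_ball_le ha _ (Real.exp_pos _)) _).trans (le_of_eq ?_)
  rw [← mul_assoc, ← ENNReal.ofReal_mul (Real.exp_pos _).le, ← Real.exp_nat_mul, ← Real.exp_add]
  have : -2 * q.1 + ((2 : ℕ) : ℝ) * q.1 = 0 := by push_cast; ring
  rw [this]; simp

/-- The weight `min 1 t⁻²` for the bounds in `L²(∂B)`. -/
noncomputable def weightOne (q : ℝ × E3) : ENNReal :=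
  ENNReal.ofReal (min 1 (Real.exp (-2 * q.1)))

@[fun_prop]
theorem measurable_weightOne : Measurable weightOne := by unfold weightOne; fun_prop

theorem weightOne_ne_zero (q : ℝ × E3) : weightOne q ≠ 0 := by
  unfold weightOne
  have : 0 < min 1 (Real.exp (-2 * q.1)) := lt_min one_pos (Real.exp_pos _)
  simpa using this

theorem lintegral_bump_weightOne (r : E3) :
    ∫⁻ q, bump r q * weightOne q ≤ scaleC * volume (Metric.ball (0 : E3) 1) := by
  unfold weightOne
  rw [lintegral_bump_mul r (h := fun τ => ENNReal.ofReal (min 1 (Real.exp (-2 * τ))))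
    (by fun_prop)]
  gcongr
  refine lintegral_mono fun τ => ?_
  rw [← ENNReal.ofReal_mul (Real.exp_pos _).le]
  refine ENNReal.ofReal_le_ofReal ?_
  rcases le_total τ 0 with h | h
  · calc Real.exp τ * min 1 (Real.exp (-2 * τ)) ≤ Real.exp τ * 1 := by
          gcongr; exact min_le_left _ _
      _ ≤ _ := by
        rw [mul_one, abs_of_nonpos h]; apply Real.exp_le_exp.2; linarith
  · calc Real.exp τ * min 1 (Real.exp (-2 * τ)) ≤ Real.exp τ * Real.exp (-2 * τ) := by
          gcongr; exact min_le_right _ _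
      _ ≤ _ := by
        rw [← Real.exp_add, abs_of_nonneg h]; apply Real.exp_le_exp.2; linarith

theorem lintegral_bump_surf_le_weightOne {a : ℝ} (ha : 0 < a) (q : ℝ × E3) :
    ∫⁻ r, bump r q ∂(surf a) ≤ (surfC + surf a Set.univ) * weightOne q := by
  have h := lintegral_bump_surf (a := a) q 1
  simp only [mul_one] at h
  rw [h, weightOne]
  rcases le_total 1 (Real.exp (-2 * q.1)) with h1 | h1
  · rw [min_eq_left h1, ENNReal.ofReal_one, mul_one]
    exact (exp_neg_two_mul_surf_ball_le ha q).trans le_self_add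
  · rw [min_eq_right h1, mul_comm]
    gcongr
    exact (measure_mono (Set.subset_univ _)).trans le_add_self

/-- The constant in the `L²` bounds. -/
noncomputable def ltwoC (a : ℝ) : ENNReal :=
  scaleC * volume (Metric.ball (0 : E3) 1) * (surfC + surf a Set.univ)

theorem ltwoC_ne_top (a : ℝ) : ltwoC a ≠ ⊤ := by
  have := scaleC_ne_top
  have := surfC_ne_top
  unfold ltwoC; finiteness

/-- The averages over scales and positions are bounded into `L²(∂B)`. -/
theorem lintegral_bump_sq_le {a : ℝ} (ha : 0 < a) {g : ℝ × E3 → ENNReal}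
    (hg : AEMeasurable g volume) :
    ∫⁻ r, (∫⁻ q, bump r q * g q) ^ 2 ∂(surf a) ≤ ltwoC a * ∫⁻ q, g q ^ 2 := by
  refine lintegral_schur (by unfold Function.uncurry; fun_prop) measurable_weightOne
    weightOne_ne_zero
    (fun q => ENNReal.ofReal_ne_top) (p := fun _ => scaleC * volume (Metric.ball (0 : E3) 1))
    measurable_const lintegral_bump_weightOne (fun q => ?_) hg
  rw [lintegral_mul_const _ (by fun_prop), mul_comm, ltwoC, mul_assoc (scaleC * _)]
  exact mul_le_mul_right (lintegral_bump_surf_le_weightOne ha q) _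

/-- The averages over `∂B` are bounded into `L²` of scale and position. -/
theorem lintegral_bump_dual_sq_le {a : ℝ} (ha : 0 < a) {f : E3 → ENNReal}
    (hf : AEMeasurable f (surf a)) :
    ∫⁻ q, (∫⁻ r, bump r q * f r ∂(surf a)) ^ 2 ≤ ltwoC a * ∫⁻ r, f r ^ 2 ∂(surf a) := by
  refine lintegral_schur (M := fun q r => bump r q) (by unfold Function.uncurry; fun_prop)
    (w := fun _ => 1) measurable_const (by simp) (by simp)
    (p := fun q => (surfC + surf a Set.univ) * weightOne q)
    (by fun_prop) (fun q => ?_) (fun r => ?_) hf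
  · simpa using lintegral_bump_surf_le_weightOne ha q
  · calc ∫⁻ q, bump r q * ((surfC + surf a Set.univ) * weightOne q)
        = ∫⁻ q, (surfC + surf a Set.univ) * (bump r q * weightOne q) := by
          refine lintegral_congr fun q => ?_; ring
      _ = (surfC + surf a Set.univ) * ∫⁻ q, bump r q * weightOne q :=
          lintegral_const_mul _ (by fun_prop)
      _ ≤ ltwoC a * 1 := by
          rw [mul_one, ltwoC, mul_comm (scaleC * _)]
          gcongr
          exact lintegral_bump_weightOne r

/-- The kernel dominating differences: `min 1 (|r - s| / t)` times `t⁻²` near `r` or `s`. -/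
noncomputable def diffBump (y : E3 × E3) (q : ℝ × E3) : ENNReal :=
  ENNReal.ofReal (min 1 (‖y.1 - y.2‖ * Real.exp (-q.1))) * (bump y.1 q + bump y.2 q)

@[fun_prop]
theorem Measurable.diffBump {α : Type*} [MeasurableSpace α] {f : α → E3 × E3} {g : α → ℝ × E3}
    (hf : Measurable f) (hg : Measurable g) : Measurable fun x => diffBump (f x) (g x) := by
  unfold Stokes.diffBump
  fun_prop

/-- `∫ t^{1/2} min(1, δ / t) dτ` is a multiple of `δ^{1/2}`. -/
theorem lintegral_exp_half_mul_min_norm {δ : ℝ} (hδ : 0 ≤ δ) :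
    ∫⁻ τ : ℝ, ENNReal.ofReal (Real.exp (τ / 2) * min 1 (δ * Real.exp (-τ)))
      = ENNReal.ofReal (√δ) * scaleC := by
  rcases hδ.eq_or_lt with rfl | hδ
  · simp
  · have := lintegral_exp_half_mul_min (Real.log δ)
    rw [← Real.log_sqrt hδ.le, Real.exp_log (Real.sqrt_pos.2 hδ)] at this
    rw [← this]
    refine lintegral_congr fun τ => ?_
    rw [sub_eq_add_neg, Real.exp_add, Real.exp_log hδ]

/-- The weight `t^{-1/2}` for the bound of the Slobodeckij seminorm. -/
noncomputable def weightHalf (q : ℝ × E3) : ENNReal := ENNReal.ofReal (Real.exp (-q.1 / 2))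

theorem lintegral_diffBump_weightHalf (y : E3 × E3) :
    ∫⁻ q, diffBump y q * weightHalf q ≤
      2 * scaleC * volume (Metric.ball (0 : E3) 1) * ENNReal.ofReal (√‖y.1 - y.2‖) := by
  have key : ∀ r : E3, ∫⁻ q, bump r q *
      ENNReal.ofReal (min 1 (‖y.1 - y.2‖ * Real.exp (-q.1)) * Real.exp (-q.1 / 2)) =
      ENNReal.ofReal (√‖y.1 - y.2‖) * scaleC * volume (Metric.ball (0 : E3) 1) := by
    intro r
    rw [lintegral_bump_mul r (h := fun τ =>
      ENNReal.ofReal (min 1 (‖y.1 - y.2‖ * Real.exp (-τ)) * Real.exp (-τ / 2))) (by fun_prop),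
      ← lintegral_exp_half_mul_min_norm (norm_nonneg _)]
    congr 1
    refine lintegral_congr fun τ => ?_
    rw [← ENNReal.ofReal_mul (Real.exp_pos _).le]
    congr 1
    rw [mul_comm (min _ _), ← mul_assoc, ← Real.exp_add]
    congr 2; ring
  have e : ∀ q, diffBump y q * weightHalf q =
      bump y.1 q * ENNReal.ofReal (min 1 (‖y.1 - y.2‖ * Real.exp (-q.1)) * Real.exp (-q.1 / 2)) +
      bump y.2 q *
        ENNReal.ofReal (min 1 (‖y.1 - y.2‖ * Real.exp (-q.1)) * Real.exp (-q.1 / 2)) := by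
    intro q
    rw [ENNReal.ofReal_mul (by positivity), diffBump, weightHalf]; ring
  simp_rw [e]
  rw [lintegral_add_left (by fun_prop), key, key]
  refine le_of_eq ?_
  ring

/-- A function of `δ` that decays like a power is controlled by an average of `1_{δ < exp θ}`. -/
theorem ofReal_radial_le {δ : ℝ} (hδ : 0 ≤ δ) (τ : ℝ) :
    ENNReal.ofReal ((δ ^ 3)⁻¹ * (√δ * min 1 (δ * Real.exp (-τ)))) ≤
      ∫⁻ θ : ℝ, if δ < Real.exp θ then ENNReal.ofReal
        (Real.exp (5 / 2) * (Real.exp (-5 / 2 * θ) * min 1 (Real.exp (θ - τ)))) else 0 := by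
  rcases hδ.eq_or_lt with rfl | hδ
  · simp
  set l := Real.log δ with hl
  have hδl : δ = Real.exp l := (Real.exp_log hδ).symm
  calc ENNReal.ofReal ((δ ^ 3)⁻¹ * (√δ * min 1 (δ * Real.exp (-τ))))
      = ENNReal.ofReal (Real.exp (-5 / 2 * l) * min 1 (Real.exp (l - τ))) *
          volume (Set.Ioo l (l + 1)) := by
        rw [Real.volume_Ioo, add_sub_cancel_left, ENNReal.ofReal_one, mul_one, ← mul_assoc]
        congr 2
        · rw [hδl, Real.sqrt_eq_rpow, ← Real.exp_mul, ← Real.exp_nat_mul, ← Real.exp_neg,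
            ← Real.exp_add]
          congr 1; push_cast; ring
        · rw [hδl, ← Real.exp_add, sub_eq_add_neg]
    _ = ∫⁻ θ in Set.Ioo l (l + 1),
          ENNReal.ofReal (Real.exp (-5 / 2 * l) * min 1 (Real.exp (l - τ))) := by
        rw [setLIntegral_const]
    _ ≤ ∫⁻ θ in Set.Ioo l (l + 1), if δ < Real.exp θ then ENNReal.ofReal
        (Real.exp (5 / 2) * (Real.exp (-5 / 2 * θ) * min 1 (Real.exp (θ - τ)))) else 0 := by
        refine setLIntegral_mono' measurableSet_Ioo fun θ hθ => ?_
        rw [if_pos (by rw [hδl]; exact Real.exp_lt_exp.2 hθ.1)]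
        refine ENNReal.ofReal_le_ofReal ?_
        rw [← mul_assoc, ← Real.exp_add]
        gcongr
        · linarith [hθ.2]
        · exact hθ.1.le
    _ ≤ _ := setLIntegral_le_lintegral _ _

/-- The integral of `δ^{-5/2} min(1, δ / t)` over `∂B` is `O(t^{-1/2})`, as areas of caps are
quadratic in their radius. -/
theorem lintegral_radial_le {a : ℝ} (ha : 0 < a) (r : E3) (τ : ℝ) :
    ∫⁻ s, ENNReal.ofReal ((‖r - s‖ ^ 3)⁻¹ * (√‖r - s‖ * min 1 (‖r - s‖ * Real.exp (-τ))))
      ∂(surf a) ≤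
      ENNReal.ofReal (Real.exp (5 / 2)) * surfC * scaleC * ENNReal.ofReal (Real.exp (-τ / 2)) := by
  set h : ℝ → ENNReal := fun θ => ENNReal.ofReal
    (Real.exp (5 / 2) * (Real.exp (-5 / 2 * θ) * min 1 (Real.exp (θ - τ)))) with hh
  have hhm : Measurable h := by fun_prop
  calc ∫⁻ s, ENNReal.ofReal ((‖r - s‖ ^ 3)⁻¹ * (√‖r - s‖ * min 1 (‖r - s‖ * Real.exp (-τ))))
        ∂(surf a)
      ≤ ∫⁻ s : E3, (∫⁻ θ : ℝ, if ‖r - s‖ < Real.exp θ then h θ else 0) ∂(surf a) :=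
        lintegral_mono fun s => ofReal_radial_le (norm_nonneg _) τ
    _ = ∫⁻ θ : ℝ, ∫⁻ s : E3, (if ‖r - s‖ < Real.exp θ then h θ else 0) ∂(surf a) := by
        refine lintegral_lintegral_swap (Measurable.aemeasurable ?_)
        exact Measurable.ite (measurableSet_lt (by fun_prop) (by fun_prop)) (by fun_prop)
          measurable_const
    _ ≤ ∫⁻ θ : ℝ, ENNReal.ofReal (Real.exp (5 / 2)) * surfC *
          ENNReal.ofReal (Real.exp (-θ / 2) * min 1 (Real.exp (-τ - -θ))) := by
        refine lintegral_mono fun θ => ?_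
        have e : ∀ s : E3, (if ‖r - s‖ < Real.exp θ then h θ else 0) =
            (Metric.ball r (Real.exp θ)).indicator (fun _ => h θ) s := by
          intro s
          simp [Set.indicator, Metric.mem_ball, dist_comm s r, dist_eq_norm]
        simp_rw [e]
        rw [lintegral_indicator_const Metric.isOpen_ball.measurableSet]
        refine (mul_le_mul_right (surf_ball_le ha _ (Real.exp_pos _)) _).trans (le_of_eq ?_)
        rw [hh]
        simp only
        rw [← mul_assoc, mul_comm _ surfC, mul_comm _ surfC, mul_assoc,
          ← ENNReal.ofReal_mul (by positivity), ← ENNReal.ofReal_mul (by positivity)]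
        congr 2
        have : Real.exp (-θ / 2) = Real.exp (-5 / 2 * θ) * Real.exp θ ^ 2 := by
          rw [← Real.exp_nat_mul, ← Real.exp_add]; congr 1; push_cast; ring
        rw [this, show -τ - -θ = θ - τ by ring]; ring
    _ = ENNReal.ofReal (Real.exp (5 / 2)) * surfC * scaleC *
          ENNReal.ofReal (Real.exp (-τ / 2)) := by
        rw [lintegral_const_mul _ (by fun_prop)]
        rw [lintegral_neg_eq_self (fun θ : ℝ => ENNReal.ofReal
          (Real.exp (θ / 2) * min 1 (Real.exp (-τ - θ)))), lintegral_exp_half_mul_min]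
        ring

/-- The constant in the bound of the Slobodeckij seminorm. -/
noncomputable def slobC : ENNReal :=
  2 * scaleC * volume (Metric.ball (0 : E3) 1) *
    (2 * (ENNReal.ofReal (Real.exp (5 / 2)) * surfC * scaleC * surfC))

theorem slobC_ne_top : slobC ≠ ⊤ := by
  have := scaleC_ne_top
  have := surfC_ne_top
  unfold slobC; finiteness

instance (a : ℝ) : SFinite (slobMeasure a) := by
  unfold slobMeasure; infer_instance

theorem measurable_slobDensity :
    Measurable fun q : E3 × E3 => ENNReal.ofReal ((‖q.1 - q.2‖ ^ 3)⁻¹) := by fun_prop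

/-- The dual half of the Schur test for the Slobodeckij seminorm. -/
theorem lintegral_diffBump_slob {a : ℝ} (ha : 0 < a) (q : ℝ × E3) :
    ∫⁻ y, diffBump y q * ENNReal.ofReal (√‖y.1 - y.2‖) ∂(slobMeasure a) ≤
      2 * (ENNReal.ofReal (Real.exp (5 / 2)) * surfC * scaleC * surfC) * weightHalf q := by
  set D : E3 → E3 → ENNReal := fun r s =>
    ENNReal.ofReal ((‖r - s‖ ^ 3)⁻¹ * (√‖r - s‖ * min 1 (‖r - s‖ * Real.exp (-q.1)))) with hD
  have hDm : Measurable (Function.uncurry D) := by unfold Function.uncurry; fun_prop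
  have hDs : ∀ r s, D r s = D s r := by
    intro r s; simp only [hD, norm_sub_rev]
  have e : ∀ y : E3 × E3, ENNReal.ofReal ((‖y.1 - y.2‖ ^ 3)⁻¹) *
      (diffBump y q * ENNReal.ofReal (√‖y.1 - y.2‖)) =
      bump y.1 q * D y.1 y.2 + bump y.2 q * D y.1 y.2 := by
    intro y
    simp only [hD, diffBump]
    rw [ENNReal.ofReal_mul (by positivity), ENNReal.ofReal_mul (by positivity)]; ring
  have half : ∫⁻ r, ∫⁻ s, bump r q * D r s ∂(surf a) ∂(surf a) ≤
      (ENNReal.ofReal (Real.exp (5 / 2)) * surfC * scaleC * surfC) * weightHalf q := by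
    calc ∫⁻ r, ∫⁻ s, bump r q * D r s ∂(surf a) ∂(surf a)
        ≤ ∫⁻ r, bump r q * (ENNReal.ofReal (Real.exp (5 / 2)) * surfC * scaleC *
            ENNReal.ofReal (Real.exp (-q.1 / 2))) ∂(surf a) := by
          refine lintegral_mono fun r => ?_
          rw [lintegral_const_mul _ (by fun_prop)]
          gcongr
          exact lintegral_radial_le ha r q.1
      _ ≤ surfC * (ENNReal.ofReal (Real.exp (5 / 2)) * surfC * scaleC *
            ENNReal.ofReal (Real.exp (-q.1 / 2))) := by
          rw [lintegral_bump_surf, mul_right_comm]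
          gcongr
          exact exp_neg_two_mul_surf_ball_le ha q
      _ = _ := by rw [weightHalf]; ring
  have m1 : Measurable fun y : E3 × E3 => bump y.1 q * D y.1 y.2 :=
    by fun_prop
  have m2 : Measurable fun y : E3 × E3 => bump y.2 q * D y.1 y.2 :=
    by fun_prop
  have m0 : Measurable fun y : E3 × E3 => diffBump y q * ENNReal.ofReal (√‖y.1 - y.2‖) := by
    fun_prop
  rw [slobMeasure, lintegral_withDensity_eq_lintegral_mul _ measurable_slobDensity m0]
  simp only [Pi.mul_apply, e]
  rw [lintegral_add_left m1, lintegral_prod _ m1.aemeasurable, lintegral_prod _ m2.aemeasurable,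
    lintegral_lintegral_swap (f := fun x y => bump y q * D x y) m2.aemeasurable]
  rw [two_mul, add_mul]
  refine add_le_add half ?_
  refine le_trans (le_of_eq ?_) half
  refine lintegral_congr fun r => lintegral_congr fun s => ?_
  rw [hDs]

/-- The averages over scales and positions have finite Slobodeckij seminorm. -/
theorem lintegral_diffBump_sq_le {a : ℝ} (ha : 0 < a) {g : ℝ × E3 → ENNReal}
    (hg : AEMeasurable g volume) :
    ∫⁻ y, (∫⁻ q, diffBump y q * g q) ^ 2 ∂(slobMeasure a) ≤ slobC * ∫⁻ q, g q ^ 2 := by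
  refine lintegral_schur (ν := slobMeasure a) (by unfold Function.uncurry; fun_prop)
    (w := weightHalf)
    (by unfold weightHalf; fun_prop)
    (fun q => by simp [weightHalf, Real.exp_pos]) (fun q => ENNReal.ofReal_ne_top)
    (p := fun y => 2 * scaleC * volume (Metric.ball (0 : E3) 1) *
      ENNReal.ofReal (√‖y.1 - y.2‖)) (by fun_prop) lintegral_diffBump_weightHalf (fun q => ?_) hg
  have m0 : Measurable fun y : E3 × E3 => diffBump y q * ENNReal.ofReal (√‖y.1 - y.2‖) := by
    fun_prop
  calc ∫⁻ y, diffBump y q * (2 * scaleC * volume (Metric.ball (0 : E3) 1) *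
          ENNReal.ofReal (√‖y.1 - y.2‖)) ∂(slobMeasure a)
      = ∫⁻ y, 2 * scaleC * volume (Metric.ball (0 : E3) 1) *
          (diffBump y q * ENNReal.ofReal (√‖y.1 - y.2‖)) ∂(slobMeasure a) := by
        refine lintegral_congr fun y => ?_; ring
    _ ≤ _ := by
        rw [lintegral_const_mul _ m0, slobC, mul_assoc _ _ (weightHalf q)]
        gcongr
        exact lintegral_diffBump_slob ha q

/-! ### The space `H^{1/2}` -/

/-- The Hilbert space in which `H^{1/2}` is embedded isometrically. -/
abbrev HalfAmbient (a : ℝ) : Type := WithLp 2 (L2 a × Lp E3 2 (slobMeasure a))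

/-- The isometric embedding of `H^{1/2}`, recording a function and its differences. -/
noncomputable def halfIncl (a : ℝ) : HHalf a →L[ℝ] HalfAmbient a := (halfGraph a).subtypeL

theorem norm_halfIncl {a : ℝ} (u : HHalf a) : ‖halfIncl a u‖ = ‖u‖ := rfl

theorem toL2_eq {a : ℝ} (u : HHalf a) : toL2 a u = (halfIncl a u).fst := rfl

theorem halfIncl_snd {a : ℝ} (u : HHalf a) :
    (halfIncl a u).snd =ᵐ[slobMeasure a] fun q => toL2 a u q.1 - toL2 a u q.2 :=
  (show (halfGraph a) from u).2

theorem toL2_injective (a : ℝ) : Function.Injective (toL2 a) := by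
  refine (injective_iff_map_eq_zero _).2 fun u hu => ?_
  have h1 : (halfIncl a u).fst = 0 := by rw [← toL2_eq, hu]
  have h2 : (halfIncl a u).snd = 0 := by
    refine Lp.ext ?_
    have e1 := (slob_fst a).ae (Lp.coeFn_zero E3 2 (surf a))
    have e2 := (slob_snd a).ae (Lp.coeFn_zero E3 2 (surf a))
    filter_upwards [halfIncl_snd u, e1, e2, Lp.coeFn_zero E3 2 (slobMeasure a)] with q h e1 e2 e3
    rw [h, hu, e1, e2, e3]; simp
  have h3 : halfIncl a u = 0 := by
    refine (WithLp.equiv 2 _).injective (Prod.ext h1 h2)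
  rw [← norm_eq_zero, ← norm_halfIncl, h3, norm_zero]

/-- Sequences converging in `L²` have almost everywhere convergent subsequences, along which the
relation between a function and its differences passes to the limit. -/
theorem isClosed_halfGraph (a : ℝ) : IsClosed (halfGraph a : Set (HalfAmbient a)) := by
  refine IsSeqClosed.isClosed fun p l hp hl => ?_
  have h1 : Filter.Tendsto (fun n => (p n).fst) Filter.atTop (nhds l.fst) :=
    ((WithLp.fstL 2 ℝ (L2 a) (Lp E3 2 (slobMeasure a))).continuous.tendsto l).comp hl
  have h2 : Filter.Tendsto (fun n => (p n).snd) Filter.atTop (nhds l.snd) :=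
    ((WithLp.sndL 2 ℝ (L2 a) (Lp E3 2 (slobMeasure a))).continuous.tendsto l).comp hl
  obtain ⟨ns, hns, e1⟩ := (tendstoInMeasure_of_tendsto_Lp h1).exists_seq_tendsto_ae
  obtain ⟨ms, hms, e2⟩ := (tendstoInMeasure_of_tendsto_Lp
    (h2.comp hns.tendsto_atTop)).exists_seq_tendsto_ae
  change l.snd =ᵐ[slobMeasure a] fun q => l.fst q.1 - l.fst q.2
  have e3 : ∀ᵐ q ∂(slobMeasure a), ∀ n, (p n).snd q = (p n).fst q.1 - (p n).fst q.2 :=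
    ae_all_iff.2 fun n => hp n
  filter_upwards [e2, e3, (slob_fst a).ae e1, (slob_snd a).ae e1] with q e2 e3 e4 e5
  refine tendsto_nhds_unique e2 ?_
  simp only [Function.comp_apply, e3]
  exact (e4.comp hms.tendsto_atTop).sub (e5.comp hms.tendsto_atTop)

instance (a : ℝ) : CompleteSpace (halfGraph a) :=
  (isClosed_halfGraph a).completeSpace_coe

instance (a : ℝ) : CompleteSpace (HHalf a) :=
  inferInstanceAs (CompleteSpace (halfGraph a))

/-- The orthogonal projection of the ambient Hilbert space onto `H^{1/2}`. -/
noncomputable def halfProj (a : ℝ) : HalfAmbient a →L[ℝ] HHalf a :=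
  (halfGraph a).orthogonalProjectionOnto

theorem halfIncl_halfProj {a : ℝ} {p : HalfAmbient a}
    (hp : p.snd =ᵐ[slobMeasure a] fun q => p.fst q.1 - p.fst q.2) :
    halfIncl a (halfProj a p) = p :=
  Submodule.starProjection_eq_self_iff.2 (show p ∈ halfGraph a from hp)

/-- The element of `H^{1/2}` with given underlying function. -/
theorem exists_hhalf {a : ℝ} {u : E3 → E3} (hu : MemLp u 2 (surf a))
    (hd : MemLp (fun q : E3 × E3 => u q.1 - u q.2) 2 (slobMeasure a)) :
    ∃ U : HHalf a, toL2 a U =ᵐ[surf a] u ∧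
      ‖U‖ ≤ (eLpNorm u 2 (surf a)).toReal +
        (eLpNorm (fun q : E3 × E3 => u q.1 - u q.2) 2 (slobMeasure a)).toReal := by
  set p : HalfAmbient a := WithLp.toLp 2 (hu.toLp u, hd.toLp _) with hp
  have hmem : p ∈ halfGraph a := by
    change p.snd =ᵐ[slobMeasure a] fun q => p.fst q.1 - p.fst q.2
    filter_upwards [hd.coeFn_toLp, (slob_fst a).ae hu.coeFn_toLp,
      (slob_snd a).ae hu.coeFn_toLp] with q h1 h2 h3
    change hd.toLp _ q = hu.toLp u q.1 - hu.toLp u q.2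
    rw [h1, h2, h3]
  refine ⟨(⟨p, hmem⟩ : halfGraph a), hu.coeFn_toLp, ?_⟩
  change ‖p‖ ≤ _
  have h := WithLp.prod_norm_sq_eq_of_L2 p
  have e1 : ‖p.fst‖ = (eLpNorm u 2 (surf a)).toReal := Lp.norm_toLp _ hu
  have e2 : ‖p.snd‖ = (eLpNorm (fun q : E3 × E3 => u q.1 - u q.2) 2 (slobMeasure a)).toReal :=
    Lp.norm_toLp _ hd
  rw [← e1, ← e2]
  refine abs_le_of_sq_le_sq' ?_ (by positivity) |>.2
  nlinarith [norm_nonneg p.fst, norm_nonneg p.snd]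

theorem ofL2_apply {a : ℝ} (f : L2 a) (φ : HHalf a) : ofL2 f φ = inner ℝ f (toL2 a φ) := rfl

/-- The adjoint of an injective operator has dense range. -/
theorem denseRange_ofL2 (a : ℝ) : DenseRange (ofL2 (a := a)) := by
  have h1 : DenseRange (ContinuousLinearMap.adjoint (toL2 a)) := by
    have h := (toL2 a).orthogonal_ker
    rw [LinearMap.ker_eq_bot.2 (toL2_injective a), Submodule.bot_orthogonal_eq_top] at h
    have h' := Submodule.dense_iff_topologicalClosure_eq_top.2 h.symm
    exact h'
  have h2 : (ofL2 (a := a)) = (InnerProductSpace.toDual ℝ (HHalf a)) ∘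
      (ContinuousLinearMap.adjoint (toL2 a)) := by
    ext f φ
    simp [ofL2_apply, ContinuousLinearMap.adjoint_inner_left]
  rw [h2]
  exact (InnerProductSpace.toDual ℝ (HHalf a)).surjective.denseRange.comp h1
    (InnerProductSpace.toDual ℝ (HHalf a)).continuous

/-! ### Averaging operators -/

/-- A profile: a function supported in the unit ball, bounded by `1` and with Lipschitz constant
`L`. The normalization `2 ≤ L` makes `L` a bound for the oscillation as well. -/
structure IsProfile (L : ℝ) (φ : E3 → ℝ) : Prop where
  two_le : 2 ≤ L
  abs_le : ∀ α, |φ α| ≤ 1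
  eq_zero : ∀ α, 1 ≤ ‖α‖ → φ α = 0
  lip : ∀ α β, |φ α - φ β| ≤ L * ‖α - β‖

/-- The profile `φ` at the scale `t = exp τ` around `x`, where `q = (τ, x)`. -/
noncomputable def prof (φ : E3 → ℝ) (r : E3) (q : ℝ × E3) : ℝ :=
  Real.exp (-2 * q.1) * φ (Real.exp (-q.1) • (r - q.2))

theorem IsProfile.continuous {L : ℝ} {φ : E3 → ℝ} (hφ : IsProfile L φ) : Continuous φ := by
  have : LipschitzWith (Real.toNNReal L) φ := LipschitzWith.of_dist_le_mul fun α β => by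
    rw [Real.dist_eq, dist_eq_norm, Real.coe_toNNReal _ (by linarith [hφ.two_le])]
    exact hφ.lip α β
  exact this.continuous

theorem IsProfile.continuous_prof {L : ℝ} {φ : E3 → ℝ} (hφ : IsProfile L φ) :
    Continuous fun z : E3 × (ℝ × E3) => prof φ z.1 z.2 := by
  have := hφ.continuous
  unfold prof; fun_prop

theorem IsProfile.abs_prof_le {L : ℝ} {φ : E3 → ℝ} (hφ : IsProfile L φ) (r : E3) (q : ℝ × E3) :
    |prof φ r q| ≤ Real.exp (-2 * q.1) := by
  rw [prof, abs_mul, abs_of_pos (Real.exp_pos _)]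
  exact mul_le_of_le_one_right (Real.exp_pos _).le (hφ.abs_le _)

theorem one_le_norm_scaled {r : E3} {q : ℝ × E3} (h : ¬ ‖r - q.2‖ < Real.exp q.1) :
    1 ≤ ‖Real.exp (-q.1) • (r - q.2)‖ := by
  rw [norm_smul, Real.norm_of_nonneg (Real.exp_pos _).le, Real.exp_neg,
    ← div_eq_inv_mul, one_le_div (Real.exp_pos _)]
  exact not_lt.1 h

theorem IsProfile.enorm_prof_le {L : ℝ} {φ : E3 → ℝ} (hφ : IsProfile L φ) (r : E3)
    (q : ℝ × E3) : ‖prof φ r q‖ₑ ≤ bump r q := by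
  unfold bump
  split_ifs with h
  · rw [Real.enorm_eq_ofReal_abs]
    exact ENNReal.ofReal_le_ofReal (hφ.abs_prof_le r q)
  · rw [prof, hφ.eq_zero _ (one_le_norm_scaled h)]; simp

theorem IsProfile.enorm_prof_sub_le {L : ℝ} {φ : E3 → ℝ} (hφ : IsProfile L φ) (r s : E3)
    (q : ℝ × E3) :
    ‖prof φ r q - prof φ s q‖ₑ ≤ ENNReal.ofReal L * diffBump (r, s) q := by
  have hL := hφ.two_le
  have key : ‖prof φ r q - prof φ s q‖ₑ ≤ ENNReal.ofReal L *
      (ENNReal.ofReal (min 1 (‖r - s‖ * Real.exp (-q.1))) *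
        ENNReal.ofReal (Real.exp (-2 * q.1))) := by
    rw [Real.enorm_eq_ofReal_abs, ← ENNReal.ofReal_mul (by positivity),
      ← ENNReal.ofReal_mul (by positivity)]
    refine ENNReal.ofReal_le_ofReal ?_
    rw [prof, prof, ← mul_sub, abs_mul, abs_of_pos (Real.exp_pos _), mul_comm, ← mul_assoc]
    gcongr
    rw [mul_min_of_nonneg _ _ (by positivity), mul_one]
    refine le_min ?_ ((hφ.lip _ _).trans (le_of_eq ?_))
    · have h1 := hφ.abs_le (Real.exp (-q.1) • (r - q.2))
      have h2 := hφ.abs_le (Real.exp (-q.1) • (s - q.2))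
      exact (abs_sub _ _).trans (by linarith)
    · rw [← smul_sub, sub_sub_sub_cancel_right, norm_smul,
        Real.norm_of_nonneg (Real.exp_pos _).le, mul_comm (Real.exp _)]
  rcases em (‖r - q.2‖ < Real.exp q.1) with h1 | h1
  · refine key.trans ?_
    unfold diffBump
    gcongr
    refine le_trans (le_of_eq ?_) le_self_add
    simp [bump, h1]
  rcases em (‖s - q.2‖ < Real.exp q.1) with h2 | h2
  · refine key.trans ?_
    unfold diffBump
    gcongr
    refine le_trans (le_of_eq ?_) le_add_self
    simp [bump, h2]
  · rw [prof, prof, hφ.eq_zero _ (one_le_norm_scaled h1), hφ.eq_zero _ (one_le_norm_scaled h2)]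
    simp

/-- The space `L²(ℝ × ℝ³; ℝ³)` of functions of a logarithmic scale and a position. -/
abbrev ScaleL2 : Type := Lp E3 2 (volume : Measure (ℝ × E3))

/-- The superposition of the rescaled profiles with coefficients `g`. -/
noncomputable def avg (φ : E3 → ℝ) (g : ℝ × E3 → E3) (r : E3) : E3 := ∫ q, prof φ r q • g q

theorem eLpNorm_two_eq {X F : Type*} [MeasurableSpace X] [NormedAddCommGroup F] (μ : Measure X)
    (f : X → F) : eLpNorm f 2 μ = (∫⁻ x, ‖f x‖ₑ ^ 2 ∂μ) ^ (1 / 2 : ℝ) := by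
  rw [eLpNorm_eq_lintegral_rpow_enorm_toReal (by norm_num) (by norm_num)]
  simp

theorem lintegral_enorm_sq_lt_top {X F : Type*} [MeasurableSpace X] [NormedAddCommGroup F]
    {μ : Measure X} {f : X → F} (hf : MemLp f 2 μ) : ∫⁻ x, ‖f x‖ₑ ^ 2 ∂μ < ⊤ := by
  have := hf.2
  rw [eLpNorm_two_eq] at this
  by_contra h
  rw [not_lt, top_le_iff] at h
  rw [h] at this
  simp at this

/-- A function dominated in mean square by an `L²` function is in `L²`. -/
theorem memLp_two_of_lintegral_le {X Y F G : Type*} [MeasurableSpace X] [MeasurableSpace Y]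
    [NormedAddCommGroup F] [NormedAddCommGroup G] {μ : Measure X} {ν : Measure Y} {f : X → F}
    {g : Y → G} {C : ENNReal} (hC : C ≠ ⊤) (hg : MemLp g 2 ν) (hf : AEStronglyMeasurable f μ)
    (h : ∫⁻ x, ‖f x‖ₑ ^ 2 ∂μ ≤ C * ∫⁻ y, ‖g y‖ₑ ^ 2 ∂ν) :
    MemLp f 2 μ ∧
      (eLpNorm f 2 μ).toReal ≤ (C ^ (1 / 2 : ℝ)).toReal * (eLpNorm g 2 ν).toReal := by
  have h1 : eLpNorm f 2 μ ≤ C ^ (1 / 2 : ℝ) * eLpNorm g 2 ν := by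
    rw [eLpNorm_two_eq, eLpNorm_two_eq, ← ENNReal.mul_rpow_of_nonneg _ _ (by norm_num)]
    gcongr
  have h2 : C ^ (1 / 2 : ℝ) * eLpNorm g 2 ν ≠ ⊤ :=
    ENNReal.mul_ne_top (ENNReal.rpow_ne_top_of_nonneg (by norm_num) hC) hg.2.ne
  refine ⟨⟨hf, h1.trans_lt h2.lt_top⟩, ?_⟩
  rw [← ENNReal.toReal_mul]
  exact ENNReal.toReal_mono h2 h1

section Averages

variable {L : ℝ} {φ : E3 → ℝ} {a : ℝ}

theorem IsProfile.aestronglyMeasurable_prof_smul (hφ : IsProfile L φ) {g : ℝ × E3 → E3}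
    (hg : AEStronglyMeasurable g volume) (r : E3) :
    AEStronglyMeasurable (fun q => prof φ r q • g q) volume :=
  ((hφ.continuous_prof.comp (Continuous.prodMk_right r)).aestronglyMeasurable).smul hg

theorem IsProfile.enorm_prof_smul_le (hφ : IsProfile L φ) (g : ℝ × E3 → E3) (r : E3)
    (q : ℝ × E3) : ‖prof φ r q • g q‖ₑ ≤ bump r q * ‖g q‖ₑ := by
  rw [enorm_smul]; gcongr; exact hφ.enorm_prof_le r q

theorem IsProfile.ae_integrable (ha : 0 < a) (hφ : IsProfile L φ) (g : ScaleL2) :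
    ∀ᵐ r ∂(surf a), Integrable (fun q => prof φ r q • g q) := by
  have hm : Measurable fun r => (∫⁻ q, bump r q * ‖g q‖ₑ) ^ 2 := by
    have hg := (Lp.stronglyMeasurable g).measurable
    refine Measurable.pow_const (Measurable.lintegral_prod_right ?_) 2
    fun_prop
  have h : ∫⁻ r, (∫⁻ q, bump r q * ‖g q‖ₑ) ^ 2 ∂(surf a) ≠ ⊤ := by
    refine ((lintegral_bump_sq_le ha (Lp.aestronglyMeasurable g).enorm).trans_lt
      (ENNReal.mul_lt_top (ltwoC_ne_top a).lt_top ?_)).ne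
    exact lintegral_enorm_sq_lt_top (Lp.memLp g)
  filter_upwards [ae_lt_top hm h] with r hr
  refine ⟨hφ.aestronglyMeasurable_prof_smul (Lp.aestronglyMeasurable g) r, ?_⟩
  refine lt_of_le_of_lt (lintegral_mono fun q => hφ.enorm_prof_smul_le g r q) ?_
  by_contra h'
  rw [not_lt, top_le_iff] at h'
  rw [h'] at hr
  simp at hr

theorem IsProfile.stronglyMeasurable_avg (hφ : IsProfile L φ) (g : ScaleL2) :
    StronglyMeasurable (avg φ g) := by
  have : StronglyMeasurable fun z : E3 × (ℝ × E3) => prof φ z.1 z.2 • g z.2 :=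
    hφ.continuous_prof.stronglyMeasurable.smul
      ((Lp.stronglyMeasurable g).comp_measurable measurable_snd)
  exact this.integral_prod_right

theorem IsProfile.lintegral_avg_sq_le (ha : 0 < a) (hφ : IsProfile L φ) (g : ScaleL2) :
    ∫⁻ r, ‖avg φ g r‖ₑ ^ 2 ∂(surf a) ≤ ltwoC a * ∫⁻ q, ‖g q‖ₑ ^ 2 := by
  refine le_trans (lintegral_mono fun r => ?_)
    (lintegral_bump_sq_le ha (Lp.aestronglyMeasurable g).enorm)
  gcongr
  refine (enorm_integral_le_lintegral_enorm _).trans ?_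
  exact lintegral_mono fun q => hφ.enorm_prof_smul_le g r q

theorem IsProfile.lintegral_avg_sub_sq_le (ha : 0 < a) (hφ : IsProfile L φ) (g : ScaleL2) :
    ∫⁻ y, ‖avg φ g y.1 - avg φ g y.2‖ₑ ^ 2 ∂(slobMeasure a) ≤
      (ENNReal.ofReal L ^ 2 * slobC) * ∫⁻ q, ‖g q‖ₑ ^ 2 := by
  have h1 := hφ.ae_integrable ha g
  have hg := (Lp.stronglyMeasurable g).measurable
  calc ∫⁻ y, ‖avg φ g y.1 - avg φ g y.2‖ₑ ^ 2 ∂(slobMeasure a)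
      ≤ ∫⁻ y, ENNReal.ofReal L ^ 2 * (∫⁻ q, diffBump y q * ‖g q‖ₑ) ^ 2 ∂(slobMeasure a) := by
        refine lintegral_mono_ae ?_
        filter_upwards [(slob_fst a).ae h1, (slob_snd a).ae h1] with y h1 h2
        rw [← mul_pow]
        gcongr
        rw [avg, avg, ← integral_sub h1 h2, ← lintegral_const_mul _ (by fun_prop)]
        refine (enorm_integral_le_lintegral_enorm _).trans (lintegral_mono fun q => ?_)
        change ‖prof φ y.1 q • g q - prof φ y.2 q • g q‖ₑ ≤ _
        rw [← sub_smul, enorm_smul, ← mul_assoc]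
        gcongr
        exact hφ.enorm_prof_sub_le y.1 y.2 q
    _ ≤ _ := by
        rw [lintegral_const_mul, mul_assoc]
        · gcongr
          exact lintegral_diffBump_sq_le ha (Lp.aestronglyMeasurable g).enorm
        · refine Measurable.pow_const (Measurable.lintegral_prod_right ?_) 2
          fun_prop

/-- Averages of `L²` functions of scale and position lie in `H^{1/2}`, boundedly. -/
theorem IsProfile.exists_avgCLM (ha : 0 < a) (hφ : IsProfile L φ) :
    ∃ A : ScaleL2 →L[ℝ] HHalf a, ∀ g : ScaleL2, toL2 a (A g) =ᵐ[surf a] avg φ g := by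
  have hC : ENNReal.ofReal L ^ 2 * slobC ≠ ⊤ := by
    have := slobC_ne_top
    finiteness
  have h0 : ∀ g : ScaleL2, ∃ U : HHalf a, toL2 a U =ᵐ[surf a] avg φ g ∧
      ‖U‖ ≤ ((ltwoC a ^ (1 / 2 : ℝ)).toReal +
        ((ENNReal.ofReal L ^ 2 * slobC) ^ (1 / 2 : ℝ)).toReal) * ‖g‖ := by
    intro g
    have hm := hφ.stronglyMeasurable_avg g
    obtain ⟨h1, h2⟩ := memLp_two_of_lintegral_le (ltwoC_ne_top a) (Lp.memLp g)
      hm.aestronglyMeasurable (hφ.lintegral_avg_sq_le ha g)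
    obtain ⟨h3, h4⟩ := memLp_two_of_lintegral_le hC (Lp.memLp g)
      ((hm.comp_measurable measurable_fst).sub
        (hm.comp_measurable measurable_snd)).aestronglyMeasurable
      (hφ.lintegral_avg_sub_sq_le ha g)
    obtain ⟨U, hU, hUn⟩ := exists_hhalf h1 h3
    refine ⟨U, hU, hUn.trans ?_⟩
    rw [add_mul]
    exact add_le_add h2 h4
  choose A hA hAn using h0
  have hadd : ∀ g h, A (g + h) = A g + A h := by
    intro g h
    refine toL2_injective a (Lp.ext ?_)
    rw [map_add]
    filter_upwards [hA (g + h), hA g, hA h, Lp.coeFn_add (toL2 a (A g)) (toL2 a (A h)),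
      hφ.ae_integrable ha g, hφ.ae_integrable ha h] with r e1 e2 e3 e4 i1 i2
    rw [e1, e4, Pi.add_apply, e2, e3, avg, avg, avg, ← integral_add i1 i2]
    refine integral_congr_ae ?_
    filter_upwards [Lp.coeFn_add g h] with q hq
    rw [hq, Pi.add_apply, smul_add]
  have hsmul : ∀ (c : ℝ) g, A (c • g) = c • A g := by
    intro c g
    refine toL2_injective a (Lp.ext ?_)
    rw [map_smul]
    filter_upwards [hA (c • g), hA g, Lp.coeFn_smul c (toL2 a (A g))] with r e1 e2 e3
    rw [e1, e3, Pi.smul_apply, e2, avg, avg, ← integral_smul]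
    refine integral_congr_ae ?_
    filter_upwards [Lp.coeFn_smul c g] with q hq
    rw [hq, Pi.smul_apply, smul_comm]
  exact ⟨LinearMap.mkContinuous ⟨⟨A, hadd⟩, hsmul⟩ _ hAn, hA⟩

end Averages

/-- The transpose of an operator from `L²` to `H^{1/2}`, as an operator from `H^{-1/2}` to `L²`. -/
noncomputable def transposeCLM {a : ℝ} (A : ScaleL2 →L[ℝ] HHalf a) :
    HNegHalf a →L[ℝ] ScaleL2 :=
  LinearMap.mkContinuous
    { toFun := fun f => (InnerProductSpace.toDual ℝ ScaleL2).symm (f.comp A)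
      map_add' := fun f g => by rw [ContinuousLinearMap.add_comp, map_add]
      map_smul' := fun c f => by
        rw [ContinuousLinearMap.smul_comp, LinearIsometryEquiv.map_smulₛₗ]; rfl } ‖A‖ fun f => by
    change ‖(InnerProductSpace.toDual ℝ ScaleL2).symm (f.comp A)‖ ≤ _
    rw [LinearIsometryEquiv.norm_map, mul_comm]
    exact f.opNorm_comp_le A

theorem inner_transposeCLM {a : ℝ} (A : ScaleL2 →L[ℝ] HHalf a) (f : HNegHalf a) (g : ScaleL2) :
    inner ℝ (transposeCLM A f) g = f (A g) :=
  InnerProductSpace.toDual_symm_apply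

/-! ### Kernels of bounded operators from `H^{-1/2}` to `H^{1/2}` -/

section Transpose

variable {L : ℝ} {χ : E3 → ℝ} {a : ℝ}

theorem memLp_integrable_surf {f : E3 → E3} (hf : MemLp f 2 (surf a)) : Integrable f (surf a) :=
  hf.integrable (by norm_num)

theorem IsProfile.integrable_prof_smul_surf (hχ : IsProfile L χ) {f : E3 → E3}
    (hf : Integrable f (surf a)) (q : ℝ × E3) :
    Integrable (fun s => prof χ s q • f s) (surf a) := by
  have := hχ.continuous_prof
  refine hf.bdd_smul (φ := fun s => prof χ s q) (Real.exp (-2 * q.1))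
    (Continuous.aestronglyMeasurable ?_)
    (Filter.Eventually.of_forall fun s => hχ.abs_prof_le s q)
  exact this.comp (Continuous.prodMk_left q)

/-- The function `q ↦ ∫ χ_q f dσ`, where `χ_q` is the rescaled profile. -/
noncomputable def avgDual (a : ℝ) (χ : E3 → ℝ) (f : E3 → E3) (q : ℝ × E3) : E3 :=
  ∫ s, prof χ s q • f s ∂(surf a)

theorem IsProfile.stronglyMeasurable_avgDual (hχ : IsProfile L χ) (f : L2 a) :
    StronglyMeasurable (avgDual a χ f) := by
  have : StronglyMeasurable fun z : (ℝ × E3) × E3 => prof χ z.2 z.1 • f z.2 :=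
    (hχ.continuous_prof.comp continuous_swap).stronglyMeasurable.smul
      ((Lp.stronglyMeasurable f).comp_measurable measurable_snd)
  exact this.integral_prod_right

theorem lintegral_bump_dual_lt_top (ha : 0 < a) (f : L2 a) :
    ∫⁻ q, (∫⁻ s, bump s q * ‖f s‖ₑ ∂(surf a)) ^ 2 < ⊤ :=
  (lintegral_bump_dual_sq_le ha (Lp.aestronglyMeasurable f).enorm).trans_lt
    (ENNReal.mul_lt_top (ltwoC_ne_top a).lt_top (lintegral_enorm_sq_lt_top (Lp.memLp f)))

theorem IsProfile.enorm_avgDual_le (hχ : IsProfile L χ) (f : E3 → E3) (q : ℝ × E3) :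
    ‖avgDual a χ f q‖ₑ ≤ ∫⁻ s, bump s q * ‖f s‖ₑ ∂(surf a) := by
  refine (enorm_integral_le_lintegral_enorm _).trans (lintegral_mono fun s => ?_)
  change ‖prof χ s q • f s‖ₑ ≤ _
  rw [enorm_smul]
  gcongr
  exact hχ.enorm_prof_le s q

theorem IsProfile.memLp_avgDual (ha : 0 < a) (hχ : IsProfile L χ) (f : L2 a) :
    MemLp (avgDual a χ f) 2 (volume : Measure (ℝ × E3)) := by
  refine ⟨(hχ.stronglyMeasurable_avgDual f).aestronglyMeasurable, ?_⟩
  rw [eLpNorm_two_eq]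
  refine ENNReal.rpow_lt_top_of_nonneg (by norm_num) (ne_of_lt ?_)
  refine lt_of_le_of_lt (lintegral_mono fun q => ?_) (lintegral_bump_dual_lt_top ha f)
  gcongr
  exact hχ.enorm_avgDual_le f q

/-- On densities in `L²`, the transposed averaging operator is an integral operator. -/
theorem IsProfile.transposeCLM_ofL2 (ha : 0 < a) (hχ : IsProfile L χ)
    {A : ScaleL2 →L[ℝ] HHalf a} (hA : ∀ g : ScaleL2, toL2 a (A g) =ᵐ[surf a] avg χ g) (f : L2 a) :
    transposeCLM A (ofL2 f) =ᵐ[volume] avgDual a χ f := by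
  have hm := hχ.memLp_avgDual ha f
  suffices h : transposeCLM A (ofL2 f) = hm.toLp _ by rw [h]; exact hm.coeFn_toLp
  refine ext_inner_right ℝ fun g => ?_
  rw [inner_transposeCLM, ofL2_apply, L2.inner_def, L2.inner_def]
  have hfm := (Lp.stronglyMeasurable f)
  have hgm := (Lp.stronglyMeasurable g)
  have hsm : StronglyMeasurable (Function.uncurry fun (s : E3) (q : ℝ × E3) =>
      prof χ s q * inner ℝ (f s) (g q)) :=
    (hχ.continuous_prof.stronglyMeasurable).mul
      ((hfm.comp_measurable measurable_fst).inner (hgm.comp_measurable measurable_snd))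
  have hint : Integrable (Function.uncurry fun (s : E3) (q : ℝ × E3) =>
      prof χ s q * inner ℝ (f s) (g q)) ((surf a).prod volume) := by
    refine ⟨hsm.aestronglyMeasurable, ?_⟩
    have hfm' := hfm.measurable
    have hgm' := hgm.measurable
    calc ∫⁻ z, ‖Function.uncurry (fun (s : E3) (q : ℝ × E3) =>
          prof χ s q * inner ℝ (f s) (g q)) z‖ₑ ∂((surf a).prod volume)
        ≤ ∫⁻ z : E3 × (ℝ × E3), (bump z.1 z.2 * ‖f z.1‖ₑ) * ‖g z.2‖ₑ ∂((surf a).prod volume) := by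
          refine lintegral_mono fun z => ?_
          simp only [Function.uncurry]
          rw [enorm_mul, mul_assoc]
          gcongr
          · exact hχ.enorm_prof_le _ _
          · rw [← enorm_norm (f z.1), ← enorm_norm (g z.2), ← enorm_mul]
            refine enorm_le_iff_norm_le.2 ?_
            rw [Real.norm_of_nonneg (by positivity : 0 ≤ ‖f z.1‖ * ‖g z.2‖)]
            exact norm_inner_le_norm _ _
      _ = ∫⁻ q, (∫⁻ s, bump s q * ‖f s‖ₑ ∂(surf a)) * ‖g q‖ₑ := by
          rw [lintegral_prod_symm _ (by fun_prop)]
          refine lintegral_congr fun q => ?_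
          change ∫⁻ s, bump s q * ‖f s‖ₑ * ‖g q‖ₑ ∂(surf a) = _
          rw [lintegral_mul_const _ (by fun_prop)]
      _ ≤ ∫⁻ q, ((∫⁻ s, bump s q * ‖f s‖ₑ ∂(surf a)) ^ 2 + ‖g q‖ₑ ^ 2) := by
          refine lintegral_mono fun q => ?_
          rcases le_total (∫⁻ s, bump s q * ‖f s‖ₑ ∂(surf a)) ‖g q‖ₑ with h | h
          · refine le_trans ?_ le_add_self
            rw [sq]; gcongr
          · refine le_trans ?_ le_self_add
            rw [sq]; gcongr
      _ < ⊤ := by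
          rw [lintegral_add_right _ (by fun_prop)]
          exact ENNReal.add_lt_top.2 ⟨lintegral_bump_dual_lt_top ha f,
            lintegral_enorm_sq_lt_top (Lp.memLp g)⟩
  have e1 : ∫ s, inner ℝ (f s) (toL2 a (A g) s) ∂(surf a) =
      ∫ s, (∫ q, prof χ s q * inner ℝ (f s) (g q)) ∂(surf a) := by
    refine integral_congr_ae ?_
    filter_upwards [hA g, hχ.ae_integrable ha g] with s hs hi
    rw [hs, avg, ← integral_inner hi]
    simp_rw [real_inner_smul_right]
  have e2 : ∫ q, inner ℝ (hm.toLp _ q) (g q) =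
      ∫ q, ∫ s, prof χ s q * inner ℝ (f s) (g q) ∂(surf a) := by
    refine integral_congr_ae ?_
    filter_upwards [hm.coeFn_toLp] with q hq
    rw [hq, avgDual, real_inner_comm, ← integral_inner
      (hχ.integrable_prof_smul_surf (memLp_integrable_surf (Lp.memLp f)) q)]
    simp_rw [real_inner_smul_right, real_inner_comm]
  rw [e1, e2, integral_integral_swap hint]

end Transpose

/-- The matrix kernel `k` defines a bounded operator from `H^{-1/2}` to `H^{1/2}`, given on `L²` by
absolutely convergent integrals. -/
def IsHalfKernel (a : ℝ) (k : E3 → E3 → E3 →L[ℝ] E3) : Prop :=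
  ∃ S : HNegHalf a →L[ℝ] HHalf a, ∀ f : L2 a, ∀ᵐ r ∂(surf a),
    Integrable (fun s => k r s (f s)) (surf a) ∧
      toL2 a (S (ofL2 f)) r = ∫ s, k r s (f s) ∂(surf a)

section Kernels

variable {a : ℝ} {k l : E3 → E3 → E3 →L[ℝ] E3}

theorem isHalfKernel_zero : IsHalfKernel a 0 :=
  ⟨0, fun f => by
    filter_upwards [Lp.coeFn_zero E3 2 (surf a)] with r h
    refine ⟨by simp, ?_⟩
    rw [zero_apply, map_zero, h]
    simp⟩

theorem IsHalfKernel.add (hk : IsHalfKernel a k) (hl : IsHalfKernel a l) :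
    IsHalfKernel a (k + l) := by
  obtain ⟨S, hS⟩ := hk
  obtain ⟨T, hT⟩ := hl
  refine ⟨S + T, fun f => ?_⟩
  filter_upwards [hS f, hT f, Lp.coeFn_add (toL2 a (S (ofL2 f))) (toL2 a (T (ofL2 f)))]
    with r h1 h2 h3
  refine ⟨h1.1.add h2.1, ?_⟩
  rw [add_apply, map_add, h3, Pi.add_apply, h1.2, h2.2,
    ← integral_add h1.1 h2.1]
  rfl

theorem IsHalfKernel.smul (hk : IsHalfKernel a k) (c : ℝ) : IsHalfKernel a (c • k) := by
  obtain ⟨S, hS⟩ := hk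
  refine ⟨c • S, fun f => ?_⟩
  filter_upwards [hS f, Lp.coeFn_smul c (toL2 a (S (ofL2 f)))] with r h1 h2
  refine ⟨h1.1.smul c, ?_⟩
  rw [smul_apply, map_smul, h2, Pi.smul_apply, h1.2, ← integral_smul]
  rfl

theorem IsHalfKernel.sum {ι : Type*} (s : Finset ι) {k : ι → E3 → E3 → E3 →L[ℝ] E3}
    (hk : ∀ i ∈ s, IsHalfKernel a (k i)) : IsHalfKernel a (∑ i ∈ s, k i) := by
  classical
  induction s using Finset.induction_on with
  | empty => simpa using isHalfKernel_zero
  | insert i s hi ih =>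
    rw [Finset.sum_insert hi]
    exact (hk i (by simp)).add (ih fun j hj => hk j (by simp [hj]))

theorem surf_singleton (ha : 0 < a) (x : E3) : surf a {x} = 0 := by
  have h1 : Filter.Tendsto (fun t : ℝ => ENNReal.ofReal (t ^ 2) * surfC)
      (nhdsWithin 0 (Set.Ioi 0)) (nhds 0) := by
    have : Filter.Tendsto (fun t : ℝ => ENNReal.ofReal (t ^ 2) * surfC) (nhds 0)
        (nhds (ENNReal.ofReal (0 ^ 2) * surfC)) :=
      ENNReal.Tendsto.mul_const (ENNReal.tendsto_ofReal (by
        exact (continuous_pow 2).tendsto (0 : ℝ))) (Or.inr surfC_ne_top)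
    simp only [ne_eq, OfNat.ofNat_ne_zero, not_false_eq_true, zero_pow, ENNReal.ofReal_zero,
      zero_mul] at this
    exact this.mono_left nhdsWithin_le_nhds
  refine le_antisymm (ge_of_tendsto h1 ?_) zero_le
  filter_upwards [self_mem_nhdsWithin] with t ht
  refine (measure_mono ?_).trans (surf_ball_le ha x ht)
  exact Set.singleton_subset_iff.2 (Metric.mem_ball_self ht)

/-- The values of a kernel on the diagonal are irrelevant. -/
theorem IsHalfKernel.congr (ha : 0 < a) (hk : IsHalfKernel a k) (h : ∀ r s, r ≠ s → k r s = l r s) :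
    IsHalfKernel a l := by
  obtain ⟨S, hS⟩ := hk
  refine ⟨S, fun f => ?_⟩
  filter_upwards [hS f] with r h1
  have e : (fun s => k r s (f s)) =ᵐ[surf a] fun s => l r s (f s) := by
    have : ∀ᵐ s ∂(surf a), s ≠ r := by
      rw [ae_iff]; simpa using surf_singleton ha r
    filter_upwards [this] with s hs
    rw [h r s hs.symm]
  exact ⟨h1.1.congr e, by rw [h1.2, integral_congr_ae e]⟩

/-- The kernel `∫ φ((r - x) / t) χ((s - x) / t) t⁻⁴ dτ dx`, with `t = exp τ`. -/
noncomputable def profKernel (φ χ : E3 → ℝ) (r s : E3) : ℝ := ∫ q, prof φ r q * prof χ s q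

/-- The operator with kernel `profKernel φ χ • M` factors through `L²` of scale and position. -/
theorem isHalfKernel_profKernel (ha : 0 < a) {L L' : ℝ} {φ χ : E3 → ℝ} (hφ : IsProfile L φ)
    (hχ : IsProfile L' χ) (M : E3 →L[ℝ] E3) :
    IsHalfKernel a fun r s => profKernel φ χ r s • M := by
  obtain ⟨A, hA⟩ := hφ.exists_avgCLM ha
  obtain ⟨B, hB⟩ := hχ.exists_avgCLM ha
  refine ⟨A.comp ((M.compLpL 2 volume).comp (transposeCLM B)), fun f => ?_⟩
  have hfm := (Lp.stronglyMeasurable f)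
  have hfm' := hfm.measurable
  have hH : Measurable fun q => ∫⁻ s, bump s q * ‖f s‖ₑ ∂(surf a) :=
    Measurable.lintegral_prod_right (by fun_prop)
  have hm : Measurable fun r => (∫⁻ q, bump r q * ∫⁻ s, bump s q * ‖f s‖ₑ ∂(surf a)) ^ 2 := by
    refine Measurable.pow_const (Measurable.lintegral_prod_right ?_) 2
    fun_prop
  have hfin : ∫⁻ r, (∫⁻ q, bump r q * ∫⁻ s, bump s q * ‖f s‖ₑ ∂(surf a)) ^ 2 ∂(surf a) ≠ ⊤ :=
    ((lintegral_bump_sq_le ha hH.aemeasurable).trans_lt (ENNReal.mul_lt_top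
      (ltwoC_ne_top a).lt_top (lintegral_bump_dual_lt_top ha f))).ne
  filter_upwards [ae_lt_top hm hfin, hA (M.compLpL 2 volume (transposeCLM B (ofL2 f)))]
    with r hr hAr
  have hr' : ∫⁻ q, bump r q * ∫⁻ s, bump s q * ‖f s‖ₑ ∂(surf a) < ⊤ := by
    by_contra h'
    rw [not_lt, top_le_iff] at h'
    rw [h'] at hr
    simp at hr
  set F : E3 → ℝ × E3 → E3 := fun s q => (prof φ r q * prof χ s q) • M (f s) with hF
  have hFm : StronglyMeasurable (Function.uncurry F) := by
    have c1 : Continuous fun z : E3 × (ℝ × E3) => prof φ r z.2 :=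
      hφ.continuous_prof.comp (by fun_prop : Continuous fun z : E3 × (ℝ × E3) => (r, z.2))
    exact (c1.mul hχ.continuous_prof).stronglyMeasurable.smul
      (M.continuous.comp_stronglyMeasurable (hfm.comp_measurable measurable_fst))
  have hint : Integrable (Function.uncurry F) ((surf a).prod volume) := by
    refine ⟨hFm.aestronglyMeasurable, ?_⟩
    calc ∫⁻ z, ‖Function.uncurry F z‖ₑ ∂((surf a).prod volume)
        ≤ ∫⁻ z : E3 × (ℝ × E3), ‖M‖ₑ * (bump r z.2 * (bump z.1 z.2 * ‖f z.1‖ₑ))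
            ∂((surf a).prod volume) := by
          refine lintegral_mono fun z => ?_
          simp only [Function.uncurry, hF]
          rw [enorm_smul, enorm_mul]
          calc ‖prof φ r z.2‖ₑ * ‖prof χ z.1 z.2‖ₑ * ‖M (f z.1)‖ₑ
              ≤ bump r z.2 * bump z.1 z.2 * (‖M‖ₑ * ‖f z.1‖ₑ) := by
                gcongr
                · exact hφ.enorm_prof_le _ _
                · exact hχ.enorm_prof_le _ _
                · exact M.le_opENorm _
            _ = _ := by ring
      _ = ∫⁻ q, ‖M‖ₑ * (bump r q * ∫⁻ s, bump s q * ‖f s‖ₑ ∂(surf a)) := by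
          rw [lintegral_prod_symm _ (by fun_prop)]
          refine lintegral_congr fun q => ?_
          change ∫⁻ s, ‖M‖ₑ * (bump r q * (bump s q * ‖f s‖ₑ)) ∂(surf a) = _
          rw [lintegral_const_mul _ (by fun_prop), lintegral_const_mul _ (by fun_prop)]
      _ < ⊤ := by
          rw [lintegral_const_mul _ (by fun_prop)]
          exact ENNReal.mul_lt_top enorm_lt_top hr'
  have hk : ∀ s, ∫ q, F s q = (profKernel φ χ r s • M) (f s) := by
    intro s
    simp only [hF]
    rw [integral_smul_const]; rfl
  refine ⟨?_, ?_⟩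
  · have := hint.integral_prod_left
    simpa only [Function.uncurry, hk] using this
  · change toL2 a (A (M.compLpL 2 volume (transposeCLM B (ofL2 f)))) r = _
    rw [hAr]
    calc avg φ (M.compLpL 2 volume (transposeCLM B (ofL2 f))) r
        = ∫ q, ∫ s, F s q ∂(surf a) := by
          refine integral_congr_ae ?_
          filter_upwards [M.coeFn_compLpL (𝕜' := ℝ) (transposeCLM B (ofL2 f)),
            hχ.transposeCLM_ofL2 ha hB f] with q h1 h2
          have hi := hχ.integrable_prof_smul_surf (memLp_integrable_surf (Lp.memLp f)) q
          rw [h1, h2, avgDual, ← M.integral_comp_comm hi, ← integral_smul]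
          refine integral_congr_ae (Filter.Eventually.of_forall fun s => ?_)
          simp only [hF, map_smul, smul_smul]
      _ = ∫ s, (∫ q, F s q) ∂(surf a) := (integral_integral_swap hint).symm
      _ = _ := by simp_rw [hk]

end Kernels

/-! ### The stokeslet as a sum of product kernels -/

/-- The tent profile. -/
noncomputable def tent (α : E3) : ℝ := max 0 (1 - ‖α‖)

theorem tent_nonneg (α : E3) : 0 ≤ tent α := le_max_left _ _

theorem continuous_tent : Continuous tent := by unfold tent; fun_prop

theorem tent_pos {α : E3} (h : ‖α‖ < 1) : 0 < tent α := lt_max_of_lt_right (by linarith)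

theorem isProfile_tent : IsProfile 2 tent where
  two_le := le_rfl
  abs_le α := by
    rw [abs_of_nonneg (tent_nonneg α)]
    exact max_le (by norm_num) (by linarith [norm_nonneg α])
  eq_zero α h := max_eq_left (by linarith)
  lip α β := by
    refine (abs_max_sub_max_le_max _ _ _ _).trans (max_le ?_ ?_)
    · rw [sub_self, abs_zero]; positivity
    · rw [sub_sub_sub_cancel_left, abs_sub_comm]
      exact (abs_norm_sub_norm_le α β).trans (by linarith [norm_nonneg (α - β)])

theorem IsProfile.coord {L : ℝ} {φ : E3 → ℝ} (hφ : IsProfile L φ) (i : Fin 3) :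
    IsProfile (L + 1) fun α => α i * φ α where
  two_le := by linarith [hφ.two_le]
  abs_le α := by
    rcases lt_or_ge ‖α‖ 1 with h | h
    · rw [abs_mul]
      have h1 : |α i| ≤ ‖α‖ := PiLp.norm_apply_le α i
      exact mul_le_one₀ (h1.trans h.le) (abs_nonneg _) (hφ.abs_le α)
    · rw [hφ.eq_zero α h]; simp
  eq_zero α h := by rw [hφ.eq_zero α h, mul_zero]
  lip := by
    have key : ∀ α β : E3, ‖β‖ < 1 → |α i * φ α - β i * φ β| ≤ (L + 1) * ‖α - β‖ := by
      intro α β h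
      have e : α i * φ α - β i * φ β = (α - β) i * φ α + β i * (φ α - φ β) := by
        simp only [PiLp.sub_apply]; ring
      have h1 : |(α - β) i| ≤ ‖α - β‖ := PiLp.norm_apply_le (α - β) i
      have h2 : |β i| ≤ 1 := (PiLp.norm_apply_le β i).trans h.le
      calc |α i * φ α - β i * φ β| ≤ |(α - β) i| * |φ α| + |β i| * |φ α - φ β| := by
            rw [e]; refine (abs_add_le _ _).trans ?_; rw [abs_mul, abs_mul]
        _ ≤ ‖α - β‖ * 1 + 1 * (L * ‖α - β‖) := by
            gcongr
            · exact hφ.abs_le α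
            · exact hφ.lip α β
        _ = _ := by ring
    intro α β
    rcases lt_or_ge ‖β‖ 1 with h | h
    · exact key α β h
    rcases lt_or_ge ‖α‖ 1 with h' | h'
    · rw [abs_sub_comm, norm_sub_rev]; exact key β α h'
    · rw [hφ.eq_zero α h', hφ.eq_zero β h]
      have := hφ.two_le
      simp only [mul_zero, sub_zero, abs_zero]; positivity

/-- Two balls of radius `t` meet only if the distance of their centres is less than `2t`. -/
theorem lintegral_bump_mul_bump_lt_top {r s : E3} (h : r ≠ s) :
    ∫⁻ q, bump r q * bump s q < ⊤ := by
  set l := Real.log (‖r - s‖ / 2) with hl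
  have hpos : 0 < ‖r - s‖ / 2 := by
    have := norm_pos_iff.2 (sub_ne_zero.2 h); positivity
  set H : ℝ → ENNReal := (Set.Ioi l).indicator fun τ => ENNReal.ofReal (Real.exp (-2 * τ)) with hH
  have hHm : Measurable H := Measurable.indicator (by fun_prop) measurableSet_Ioi
  have hle : ∀ q, bump r q * bump s q ≤ bump r q * H q.1 := by
    intro q
    unfold bump
    split_ifs with h1 h2
    · gcongr
      rw [hH, Set.indicator_of_mem]
      rw [Set.mem_Ioi, hl, Real.log_lt_iff_lt_exp hpos]
      have : ‖r - s‖ ≤ ‖r - q.2‖ + ‖s - q.2‖ := by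
        rw [norm_sub_rev s]; exact norm_sub_le_norm_sub_add_norm_sub _ _ _
      linarith
    · simp
    · simp
    · simp
  refine lt_of_le_of_lt (lintegral_mono hle) ?_
  rw [lintegral_bump_mul r hHm]
  refine ENNReal.mul_lt_top ?_ measure_ball_lt_top
  have e : ∀ τ : ℝ, ENNReal.ofReal (Real.exp τ) * H τ =
      (Set.Ioi l).indicator (fun τ => ENNReal.ofReal (Real.exp (-τ))) τ := by
    intro τ
    by_cases hτ : τ ∈ Set.Ioi l
    · rw [hH, Set.indicator_of_mem hτ, Set.indicator_of_mem hτ,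
        ← ENNReal.ofReal_mul (Real.exp_pos _).le, ← Real.exp_add]
      congr 2; ring
    · rw [hH, Set.indicator_of_notMem hτ, Set.indicator_of_notMem hτ, mul_zero]
  simp_rw [e]
  rw [lintegral_indicator measurableSet_Ioi]
  exact (integrableOn_exp_neg_Ioi l).lintegral_lt_top

theorem IsProfile.integrable_prof_mul_prof {L L' : ℝ} {φ χ : E3 → ℝ} (hφ : IsProfile L φ)
    (hχ : IsProfile L' χ) {r s : E3} (h : r ≠ s) :
    Integrable fun q => prof φ r q * prof χ s q := by
  have c : Continuous fun q => prof φ r q * prof χ s q :=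
    (hφ.continuous_prof.comp (Continuous.prodMk_right r)).mul
      (hχ.continuous_prof.comp (Continuous.prodMk_right s))
  refine ⟨c.aestronglyMeasurable, lt_of_le_of_lt (lintegral_mono fun q => ?_)
    (lintegral_bump_mul_bump_lt_top h)⟩
  rw [enorm_mul]
  gcongr
  · exact hφ.enorm_prof_le r q
  · exact hχ.enorm_prof_le s q

/-- The integrand of the tent kernel with an additional factor `t^{-p}`. -/
noncomputable def tentInt (p : ℕ) (r s : E3) (q : ℝ × E3) : ℝ :=
  Real.exp (-p * q.1) * (prof tent r q * prof tent s q)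

theorem integrable_tentInt (p : ℕ) {r s : E3} (h : r ≠ s) : Integrable (tentInt p r s) := by
  have hpos : 0 < ‖r - s‖ := norm_pos_iff.2 (sub_ne_zero.2 h)
  have hi := isProfile_tent.integrable_prof_mul_prof isProfile_tent h
  refine (hi.norm.const_mul ((2 / ‖r - s‖) ^ p)).mono' ?_ ?_
  · exact (Continuous.aestronglyMeasurable (by fun_prop)).mul hi.aestronglyMeasurable
  refine Filter.Eventually.of_forall fun q => ?_
  rw [tentInt, norm_mul, Real.norm_of_nonneg (Real.exp_pos _).le]
  by_cases h0 : prof tent r q * prof tent s q = 0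
  · rw [h0]; simp
  gcongr
  have h1 : ‖r - q.2‖ < Real.exp q.1 := by
    by_contra h'
    exact h0 (by rw [prof, isProfile_tent.eq_zero _ (one_le_norm_scaled h')]; simp)
  have h2 : ‖s - q.2‖ < Real.exp q.1 := by
    by_contra h'
    exact h0 (by rw [prof, prof, isProfile_tent.eq_zero _ (one_le_norm_scaled h')]; simp)
  have h3 : ‖r - s‖ ≤ ‖r - q.2‖ + ‖s - q.2‖ := by
    rw [norm_sub_rev s]; exact norm_sub_le_norm_sub_add_norm_sub _ _ _
  have h4 : Real.exp (-p * q.1) = (Real.exp (-q.1)) ^ p := by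
    rw [← Real.exp_nat_mul]; congr 1; ring
  rw [h4, Real.exp_neg]
  gcongr
  rw [inv_le_comm₀ (Real.exp_pos _) (by positivity), inv_div]
  linarith

/-- The autocorrelation of the tent profile. -/
noncomputable def tentCorr (z : E3) : ℝ := ∫ y, tent (z - y) * tent y

theorem tentCorr_eq_of_norm_eq {z w : E3} (h : ‖z‖ = ‖w‖) : tentCorr z = tentCorr w := by
  obtain ⟨e, he⟩ : ∃ e : E3 ≃ₗᵢ[ℝ] E3, e z = w := by
    exact ⟨_, Submodule.reflection_sub h⟩
  unfold tentCorr
  refine Eq.trans ?_ (e.measurePreserving.integral_comp e.toHomeomorph.measurableEmbedding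
    fun y => tent (w - y) * tent y)
  refine integral_congr_ae (Filter.Eventually.of_forall fun y => ?_)
  simp only [tent]
  rw [← he, ← map_sub, e.norm_map, e.norm_map]

theorem tentCorr_nonneg (z : E3) : 0 ≤ tentCorr z :=
  integral_nonneg fun _ => mul_nonneg (tent_nonneg _) (tent_nonneg _)

theorem tentCorr_pos {z : E3} (hz : ‖z‖ < 1) : 0 < tentCorr z := by
  have hc := continuous_tent
  refine Continuous.integral_pos_of_hasCompactSupport_nonneg_nonzero (x := 0) (by fun_prop) ?_
    (fun _ => mul_nonneg (tent_nonneg _) (tent_nonneg _)) ?_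
  · refine HasCompactSupport.mul_left ?_
    refine HasCompactSupport.intro (isCompact_closedBall (0 : E3) 1) fun y hy => ?_
    rw [mem_closedBall_zero_iff, not_le] at hy
    exact isProfile_tent.eq_zero y hy.le
  · simp only [sub_zero]
    exact (mul_pos (tent_pos hz) (tent_pos (by simp))).ne'

theorem integral_tentInt_snd (p : ℕ) (r s : E3) (τ : ℝ) :
    ∫ x, tentInt p r s (τ, x) =
      Real.exp (-(1 + p) * τ) * tentCorr (Real.exp (-τ) • (r - s)) := by
  have h1 : ∀ x, tentInt p r s (τ, x) = Real.exp (-(4 + p) * τ) *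
      (tent (Real.exp (-τ) • (r - s) - Real.exp (-τ) • (x - s)) *
        tent (Real.exp (-τ) • (x - s))) := by
    intro x
    simp only [tentInt, prof]
    have e1 : tent (Real.exp (-τ) • (s - x)) = tent (Real.exp (-τ) • (x - s)) := by
      unfold tent; rw [← neg_sub x s, smul_neg, norm_neg]
    have e2 : Real.exp (-(4 + p) * τ) =
        Real.exp (-p * τ) * (Real.exp (-2 * τ) * Real.exp (-2 * τ)) := by
      rw [← Real.exp_add, ← Real.exp_add]; congr 1; ring
    rw [e1, e2, ← smul_sub, sub_sub_sub_cancel_right]; ring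
  simp_rw [h1]
  rw [integral_const_mul, integral_sub_right_eq_self (fun x => tent (Real.exp (-τ) • (r - s) -
    Real.exp (-τ) • x) * tent (Real.exp (-τ) • x)) s,
    Measure.integral_comp_smul volume (fun x => tent (Real.exp (-τ) • (r - s) - x) * tent x)]
  have h3 : Module.finrank ℝ E3 = 3 := by simp
  rw [h3, smul_eq_mul, ← mul_assoc, abs_of_pos (by positivity), tentCorr]
  congr 1
  rw [← Real.exp_nat_mul, ← Real.exp_neg, ← Real.exp_add]
  congr 1; push_cast; ring

/-- The constant in `∫ tentInt p r s = tentC p * |r - s|^{-(1 + p)}`. -/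
noncomputable def tentC (p : ℕ) : ℝ :=
  ∫ τ : ℝ, Real.exp (-(1 + p) * τ) *
    tentCorr (Real.exp (-τ) • EuclideanSpace.single (0 : Fin 3) (1 : ℝ))

theorem tentC_pos (p : ℕ) : 0 < tentC p := by
  set e : E3 := EuclideanSpace.single (0 : Fin 3) (1 : ℝ) with he
  have hen : ‖e‖ = 1 := by simp [he]
  have hi : Integrable fun τ : ℝ =>
      Real.exp (-(1 + p) * τ) * tentCorr (Real.exp (-τ) • e) := by
    have h := (integrable_tentInt p (r := e) (s := 0) (by
      rw [← norm_pos_iff, hen]; norm_num)).integral_prod_left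
    simpa only [integral_tentInt_snd, sub_zero] using h
  refine (integral_pos_iff_support_of_nonneg (fun τ => mul_nonneg (Real.exp_pos _).le
    (tentCorr_nonneg _)) hi).2 ?_
  refine lt_of_lt_of_le (?_ : 0 < volume (Set.Ioi (0 : ℝ))) (measure_mono fun τ hτ => ?_)
  · simp
  · refine (mul_pos (Real.exp_pos _) (tentCorr_pos ?_)).ne'
    rw [norm_smul, hen, mul_one, Real.norm_of_nonneg (Real.exp_pos _).le, Real.exp_lt_one_iff]
    simpa using hτ

/-- Homogeneity and rotation invariance determine the kernel up to the constant `tentC p`. -/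
theorem integral_tentInt (p : ℕ) {r s : E3} (h : r ≠ s) :
    ∫ q, tentInt p r s q = tentC p * (‖r - s‖ ^ (1 + p))⁻¹ := by
  have hpos : 0 < ‖r - s‖ := norm_pos_iff.2 (sub_ne_zero.2 h)
  have hprod := integral_prod (μ := (volume : Measure ℝ)) (ν := (volume : Measure E3)) _
    (integrable_tentInt p h)
  rw [← Measure.volume_eq_prod] at hprod
  rw [hprod]
  simp_rw [integral_tentInt_snd]
  -- the substitution `t ↦ t ‖r - s‖` in the scale
  rw [← integral_add_right_eq_self _ (Real.log ‖r - s‖), tentC, mul_comm, ← integral_const_mul]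
  refine integral_congr_ae (Filter.Eventually.of_forall fun τ => ?_)
  simp only
  rw [← mul_assoc]
  congr 1
  · rw [mul_add, Real.exp_add, mul_comm]
    congr 1
    rw [← Real.rpow_natCast, ← Real.rpow_neg hpos.le, Real.rpow_def_of_pos hpos]
    congr 1; push_cast; ring
  · refine tentCorr_eq_of_norm_eq ?_
    rw [norm_smul, norm_smul, neg_add, Real.exp_add, Real.exp_neg (Real.log _), Real.exp_log hpos]
    rw [Real.norm_of_nonneg (by positivity), Real.norm_of_nonneg (by positivity), mul_assoc,
      inv_mul_cancel₀ hpos.ne']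
    simp

/-- The stokeslet as a linear map. -/
noncomputable def stokesletCLM (η : ℝ) (z : E3) : E3 →L[ℝ] E3 :=
  (8 * Real.pi * η)⁻¹ • (‖z‖⁻¹ • ContinuousLinearMap.id ℝ E3 +
    (‖z‖ ^ 3)⁻¹ • (innerSL ℝ z).smulRight z)

theorem stokesletCLM_apply (η : ℝ) (z v : E3) : stokesletCLM η z v = stokeslet η z v := by
  simp [stokesletCLM, stokeslet]

/-- The matrix unit with entry `1` in row `i` and column `j`. -/
noncomputable def matUnit (i j : Fin 3) : E3 →L[ℝ] E3 :=
  (EuclideanSpace.proj j : E3 →L[ℝ] ℝ).smulRight (EuclideanSpace.single i 1)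

theorem sum_matUnit (z : E3) :
    (innerSL ℝ z).smulRight z = ∑ i, ∑ j, (z i * z j) • matUnit i j := by
  ext v l
  simp [matUnit, PiLp.inner_apply, Fin.sum_univ_three]
  fin_cases l <;> simp <;> ring

/-- As `r - s = (r - x) - (s - x)`, the kernel `z_i z_j |z|⁻³` is a sum of product kernels. -/
theorem profKernel_coord (i j : Fin 3) {r s : E3} (h : r ≠ s) :
    profKernel (fun α => α i * (α j * tent α)) tent r s
      - profKernel (fun α => α i * tent α) (fun α => α j * tent α) r s
      - profKernel (fun α => α j * tent α) (fun α => α i * tent α) r s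
      + profKernel tent (fun α => α i * (α j * tent α)) r s
    = tentC 2 * ((‖r - s‖ ^ 3)⁻¹ * ((r - s) i * (r - s) j)) := by
  have h0 := isProfile_tent
  have h1 := fun i => h0.coord i
  have h2 := (h1 j).coord i
  have i1 := h2.integrable_prof_mul_prof h0 h
  have i2 := (h1 i).integrable_prof_mul_prof (h1 j) h
  have i3 := (h1 j).integrable_prof_mul_prof (h1 i) h
  have i4 := h0.integrable_prof_mul_prof h2 h
  unfold profKernel
  rw [← integral_sub' i1 i2, ← integral_sub' (i1.sub i2) i3,
    ← integral_add' ((i1.sub i2).sub i3) i4, ← mul_assoc, ← integral_tentInt 2 h,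
    ← integral_mul_const]
  refine integral_congr_ae (Filter.Eventually.of_forall fun q => ?_)
  simp only [Pi.add_apply, Pi.sub_apply, tentInt, prof, PiLp.smul_apply, PiLp.sub_apply,
    smul_eq_mul]
  have e : Real.exp (-((2 : ℕ) : ℝ) * q.1) = Real.exp (-q.1) * Real.exp (-q.1) := by
    rw [← Real.exp_add]; congr 1; push_cast; ring
  rw [e]; ring

theorem profKernel_tent {r s : E3} (h : r ≠ s) :
    profKernel tent tent r s = tentC 0 * ‖r - s‖⁻¹ := by
  have := integral_tentInt 0 h
  simpa [tentInt, profKernel] using this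

/-- The single-layer operator of one sphere is bounded from `H^{-1/2}` to `H^{1/2}`. -/
theorem isHalfKernel_stokeslet {a : ℝ} (ha : 0 < a) (η : ℝ) :
    IsHalfKernel a fun r s => stokesletCLM η (r - s) := by
  have h0 := isProfile_tent
  have h1 := fun i => h0.coord i
  have h2 := fun i j => (h1 j).coord i
  have k0 := (isHalfKernel_profKernel ha h0 h0 (ContinuousLinearMap.id ℝ E3)).smul (tentC 0)⁻¹
  have k2 : ∀ i j, IsHalfKernel a _ := fun i j =>
    (((isHalfKernel_profKernel ha (h2 i j) h0 (matUnit i j)).add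
      ((isHalfKernel_profKernel ha (h1 i) (h1 j) (matUnit i j)).smul (-1))).add
      ((isHalfKernel_profKernel ha (h1 j) (h1 i) (matUnit i j)).smul (-1))).add
      (isHalfKernel_profKernel ha h0 (h2 i j) (matUnit i j))
  have k3 := (IsHalfKernel.sum Finset.univ fun i _ =>
    IsHalfKernel.sum Finset.univ fun j _ => k2 i j).smul (tentC 2)⁻¹
  refine ((k0.add k3).smul (8 * Real.pi * η)⁻¹).congr ha fun r s h => ?_
  have c0 := (tentC_pos 0).ne'
  have c2 := (tentC_pos 2).ne'
  simp only [Pi.add_apply, Pi.smul_apply, Finset.sum_apply]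
  rw [stokesletCLM, sum_matUnit]
  congr 2
  · rw [profKernel_tent h, smul_smul, ← mul_assoc, inv_mul_cancel₀ c0, one_mul]
  · rw [Finset.smul_sum, Finset.smul_sum]
    refine Finset.sum_congr rfl fun i _ => ?_
    rw [Finset.smul_sum, Finset.smul_sum]
    refine Finset.sum_congr rfl fun j _ => ?_
    have e := profKernel_coord i j h
    rw [← inv_mul_eq_iff_eq_mul₀ c2] at e
    rw [smul_smul (‖r - s‖ ^ 3)⁻¹, ← e]
    module

/-! ### Operators with smooth kernels -/

/-- A bilinear map into functions with a common `L²` majorant is a bounded bilinear map into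
`L²`. -/
theorem exists_lp_bilinear {Y C H : Type*} [MeasurableSpace Y] {μ : Measure Y}
    [NormedAddCommGroup C] [NormedSpace ℝ C] [NormedAddCommGroup H] [NormedSpace ℝ H]
    {Φ : C → H → Y → E3} {w : Y → ℝ} (hw : MemLp w 2 μ)
    (hm : ∀ g h, AEStronglyMeasurable (Φ g h) μ)
    (hb : ∀ g h y, ‖Φ g h y‖ ≤ ‖g‖ * ‖h‖ * w y)
    (add₁ : ∀ g g' h y, Φ (g + g') h y = Φ g h y + Φ g' h y)
    (smul₁ : ∀ (c : ℝ) g h y, Φ (c • g) h y = c • Φ g h y)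
    (add₂ : ∀ g h h' y, Φ g (h + h') y = Φ g h y + Φ g h' y)
    (smul₂ : ∀ (c : ℝ) g h y, Φ g (c • h) y = c • Φ g h y) :
    ∃ Γ : C →L[ℝ] H →L[ℝ] Lp E3 2 μ, ∀ g h, Γ g h =ᵐ[μ] Φ g h := by
  have hb' : ∀ g h y, ‖Φ g h y‖ ≤ ‖g‖ * ‖h‖ * ‖w y‖ := fun g h y =>
    (hb g h y).trans (by gcongr; exact Real.le_norm_self _)
  have hL : ∀ g h, MemLp (Φ g h) 2 μ := fun g h =>
    hw.of_le_mul (hm g h) (Filter.Eventually.of_forall (hb' g h))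
  refine ⟨LinearMap.mkContinuous₂ (LinearMap.mk₂ ℝ (fun g h => (hL g h).toLp) ?_ ?_ ?_ ?_)
    (eLpNorm w 2 μ).toReal ?_, fun g h => (hL g h).coeFn_toLp⟩
  · intro g g' h
    rw [← MemLp.toLp_add]
    exact MemLp.toLp_congr _ _ (Filter.Eventually.of_forall (add₁ g g' h))
  · intro c g h
    rw [← MemLp.toLp_const_smul]
    exact MemLp.toLp_congr _ _ (Filter.Eventually.of_forall (smul₁ c g h))
  · intro g h h'
    rw [← MemLp.toLp_add]
    exact MemLp.toLp_congr _ _ (Filter.Eventually.of_forall (add₂ g h h'))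
  · intro c g h
    rw [← MemLp.toLp_const_smul]
    exact MemLp.toLp_congr _ _ (Filter.Eventually.of_forall (smul₂ c g h))
  · intro g h
    rw [LinearMap.mk₂_apply, Lp.norm_toLp, mul_assoc, mul_comm]
    have h1 := eLpNorm_le_mul_eLpNorm_of_ae_le_mul (p := 2)
      (Filter.Eventually.of_forall (hb' g h) : ∀ᵐ y ∂μ, _)
    have h2 := ENNReal.toReal_mono (ENNReal.mul_ne_top ENNReal.ofReal_ne_top hw.2.ne) h1
    rwa [ENNReal.toReal_mul, ENNReal.toReal_ofReal (by positivity)] at h2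

/-- The closed ball containing `∂B`. -/
abbrev ClosedB (a : ℝ) : Type := Metric.closedBall (0 : E3) a

instance (a : ℝ) : CompactSpace (ClosedB a) :=
  isCompact_iff_compactSpace.1 (isCompact_closedBall _ _)

/-- The inclusion of the closed ball in space. -/
def ballIncl (a : ℝ) : C(ClosedB a, E3) := ⟨Subtype.val, continuous_subtype_val⟩

/-- The radial retraction of space onto the closed ball. -/
noncomputable def ballRetract {a : ℝ} (ha : 0 < a) : C(E3, ClosedB a) where
  toFun r := ⟨(max 1 (‖r‖ / a))⁻¹ • r, by
    have h0 : (0 : ℝ) < max 1 (‖r‖ / a) := by positivity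
    rw [mem_closedBall_zero_iff, norm_smul, norm_inv, Real.norm_of_nonneg h0.le,
      inv_mul_le_iff₀ h0, mul_comm, ← div_le_iff₀' ha]
    exact le_max_right _ _⟩
  continuous_toFun := by
    have h : Continuous fun r : E3 => (max 1 (‖r‖ / a))⁻¹ • r := by
      refine Continuous.smul (Continuous.inv₀ (f := fun r : E3 => max 1 (‖r‖ / a))
        (by fun_prop) fun r => ?_) continuous_id
      positivity
    exact h.subtype_mk _

theorem ballRetract_of_norm_le {a : ℝ} (ha : 0 < a) {r : E3} (hr : ‖r‖ ≤ a) :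
    ballRetract ha r = ⟨r, mem_closedBall_zero_iff.2 hr⟩ := by
  refine Subtype.ext ?_
  change (max 1 (‖r‖ / a))⁻¹ • r = r
  rw [max_eq_left (by rwa [div_le_one ha])]
  simp

theorem memLp_dist_slob {a : ℝ} (ha : 0 < a) :
    MemLp (fun q : E3 × E3 => ‖q.1 - q.2‖) 2 (slobMeasure a) := by
  refine ⟨Continuous.aestronglyMeasurable (by fun_prop), ?_⟩
  rw [eLpNorm_two_eq]
  refine ENNReal.rpow_lt_top_of_nonneg (by norm_num) (ne_of_lt ?_)
  rw [slobMeasure, lintegral_withDensity_eq_lintegral_mul _ measurable_slobDensity (by fun_prop),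
    lintegral_prod _ (by fun_prop)]
  have h2a : (0 : ℝ) < 2 * a := by positivity
  -- the scale `exp τ = 2 a` is the diameter, so that the minimum in the radial bound is `δ / (2 a)`
  set τ := Real.log (2 * a) with hτ
  have key : ∀ δ : ℝ, 0 ≤ δ → δ ≤ 2 * a → ENNReal.ofReal ((δ ^ 3)⁻¹) * ENNReal.ofReal δ ^ 2 ≤
      ENNReal.ofReal (√(2 * a) * (2 * a)) *
        ENNReal.ofReal ((δ ^ 3)⁻¹ * (√δ * min 1 (δ * Real.exp (-τ)))) := by
    intro δ h0 h1
    rw [← ENNReal.ofReal_pow h0, ← ENNReal.ofReal_mul (by positivity),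
      ← ENNReal.ofReal_mul (by positivity)]
    refine ENNReal.ofReal_le_ofReal ?_
    rw [mul_left_comm]
    gcongr
    rw [Real.exp_neg, hτ, Real.exp_log h2a, min_eq_right (by
      rw [← div_eq_mul_inv, div_le_one h2a]; exact h1)]
    calc δ ^ 2 = √δ * √δ * δ := by rw [Real.mul_self_sqrt h0]; ring
      _ ≤ √(2 * a) * √δ * δ := by gcongr
      _ = _ := by field_simp
  have hle : ∀ᵐ r ∂(surf a), ∫⁻ s, ENNReal.ofReal ((‖r - s‖ ^ 3)⁻¹) * ‖‖r - s‖‖ₑ ^ 2 ∂(surf a) ≤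
      ENNReal.ofReal (√(2 * a) * (2 * a)) * (ENNReal.ofReal (Real.exp (5 / 2)) * surfC * scaleC *
        ENNReal.ofReal (Real.exp (-τ / 2))) := by
    filter_upwards [ae_surf_norm_le ha] with r hr
    refine le_trans (lintegral_mono_ae ?_)
      ((lintegral_const_mul _ (by fun_prop)).trans_le
        (mul_le_mul_right (lintegral_radial_le ha r τ) _))
    filter_upwards [ae_surf_norm_le ha] with s hs
    rw [Real.enorm_eq_ofReal (norm_nonneg _)]
    refine key _ (norm_nonneg _) ((norm_sub_le _ _).trans (by linarith))
  refine lt_of_le_of_lt (lintegral_mono_ae hle) ?_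
  have := scaleC_ne_top
  have := surfC_ne_top
  rw [lintegral_const]
  finiteness

section Trace

set_option maxSynthPendingDepth 3

variable {a : ℝ} {H : Type*} [NormedAddCommGroup H] [NormedSpace ℝ H]

/-- Restriction to the sphere, for fields of operators. The retraction `ballRetract` only extends
fields on the closed ball to all of space. -/
theorem exists_restriction (ha : 0 < a) :
    ∃ Γ : C(ClosedB a, H →L[ℝ] E3) →L[ℝ] H →L[ℝ] L2 a,
      ∀ g h, Γ g h =ᵐ[surf a] fun r => g (ballRetract ha r) h := by
  refine exists_lp_bilinear (memLp_const (1 : ℝ) : MemLp (fun _ : E3 => (1 : ℝ)) 2 (surf a))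
    (fun g h => Continuous.aestronglyMeasurable ?_)
    (fun g h r => ?_) ?_ ?_ ?_ ?_
  · fun_prop
  · rw [mul_one]
    refine ((g _).le_opNorm h).trans ?_
    gcongr
    exact g.norm_coe_le_norm _
  all_goals intros; simp

/-- The integral of a field of linear maps along the segment from `q.2` to `q.1`. -/
noncomputable def segIntegral (ha : 0 < a) (g : C(ClosedB a, E3 →L[ℝ] H →L[ℝ] E3)) (h : H)
    (q : E3 × E3) : E3 :=
  ∫ τ in (0 : ℝ)..1, g (ballRetract ha (q.2 + τ • (q.1 - q.2))) (q.1 - q.2) h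

theorem continuous_segIntegrand (ha : 0 < a) (g : C(ClosedB a, E3 →L[ℝ] H →L[ℝ] E3)) (h : H) :
    Continuous fun z : (E3 × E3) × ℝ =>
      g (ballRetract ha (z.1.2 + z.2 • (z.1.1 - z.1.2))) (z.1.1 - z.1.2) h := by
  fun_prop

theorem intervalIntegrable_segIntegrand (ha : 0 < a) (g : C(ClosedB a, E3 →L[ℝ] H →L[ℝ] E3))
    (h : H) (q : E3 × E3) : IntervalIntegrable
      (fun τ : ℝ => g (ballRetract ha (q.2 + τ • (q.1 - q.2))) (q.1 - q.2) h) volume 0 1 :=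
  ((continuous_segIntegrand ha g h).comp (Continuous.prodMk_right q)).intervalIntegrable _ _

theorem norm_segIntegral_le (ha : 0 < a) (g : C(ClosedB a, E3 →L[ℝ] H →L[ℝ] E3)) (h : H)
    (q : E3 × E3) : ‖segIntegral ha g h q‖ ≤ ‖g‖ * ‖h‖ * ‖q.1 - q.2‖ := by
  have key : ∀ k : ClosedB a, ‖g k (q.1 - q.2) h‖ ≤ ‖g‖ * ‖h‖ * ‖q.1 - q.2‖ := fun k =>
    calc ‖g k (q.1 - q.2) h‖ ≤ ‖g k (q.1 - q.2)‖ * ‖h‖ := (g k (q.1 - q.2)).le_opNorm h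
      _ ≤ (‖g k‖ * ‖q.1 - q.2‖) * ‖h‖ := by gcongr; exact (g k).le_opNorm _
      _ ≤ (‖g‖ * ‖q.1 - q.2‖) * ‖h‖ := by gcongr; exact g.norm_coe_le_norm k
      _ = _ := by ring
  have := intervalIntegral.norm_integral_le_of_norm_le_const (a := (0 : ℝ)) (b := 1)
    (f := fun τ => g (ballRetract ha (q.2 + τ • (q.1 - q.2))) (q.1 - q.2) h) (fun τ _ => key _)
  rwa [sub_zero, abs_one, mul_one] at this

theorem segIntegral_add_left (ha : 0 < a) (g g' : C(ClosedB a, E3 →L[ℝ] H →L[ℝ] E3)) (h : H)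
    (q : E3 × E3) : segIntegral ha (g + g') h q = segIntegral ha g h q + segIntegral ha g' h q :=
  intervalIntegral.integral_add (intervalIntegrable_segIntegrand ha g h q)
    (intervalIntegrable_segIntegrand ha g' h q)

theorem segIntegral_smul_left (ha : 0 < a) (c : ℝ) (g : C(ClosedB a, E3 →L[ℝ] H →L[ℝ] E3))
    (h : H) (q : E3 × E3) : segIntegral ha (c • g) h q = c • segIntegral ha g h q :=
  intervalIntegral.integral_smul c
    fun τ => g (ballRetract ha (q.2 + τ • (q.1 - q.2))) (q.1 - q.2) h

theorem segIntegral_add_right (ha : 0 < a) (g : C(ClosedB a, E3 →L[ℝ] H →L[ℝ] E3)) (h h' : H)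
    (q : E3 × E3) : segIntegral ha g (h + h') q = segIntegral ha g h q + segIntegral ha g h' q := by
  unfold segIntegral
  simp only [map_add]
  exact intervalIntegral.integral_add (intervalIntegrable_segIntegrand ha g h q)
    (intervalIntegrable_segIntegrand ha g h' q)

theorem segIntegral_smul_right (ha : 0 < a) (c : ℝ) (g : C(ClosedB a, E3 →L[ℝ] H →L[ℝ] E3))
    (h : H) (q : E3 × E3) : segIntegral ha g (c • h) q = c • segIntegral ha g h q := by
  unfold segIntegral
  simp only [map_smul]
  exact intervalIntegral.integral_smul c _

theorem continuous_unitIntegral {f : (E3 × E3) × ℝ → E3} (hf : Continuous f) :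
    Continuous fun q => ∫ τ in (0 : ℝ)..1, f (q, τ) :=
  intervalIntegral.continuous_parametric_intervalIntegral_of_continuous'
    (f := fun q τ => f (q, τ)) hf 0 1

theorem continuous_segIntegral (ha : 0 < a) (g : C(ClosedB a, E3 →L[ℝ] H →L[ℝ] E3)) (h : H) :
    Continuous (segIntegral ha g h) := by
  have := continuous_unitIntegral (continuous_segIntegrand ha g h)
  exact this

/-- A field playing the role of a derivative determines differences that are square integrable for
the Slobodeckij measure. -/
theorem exists_differences (ha : 0 < a) :
    ∃ Γ : C(ClosedB a, E3 →L[ℝ] H →L[ℝ] E3) →L[ℝ] H →L[ℝ] Lp E3 2 (slobMeasure a),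
      ∀ g h, Γ g h =ᵐ[slobMeasure a] segIntegral ha g h :=
  exists_lp_bilinear (memLp_dist_slob ha)
    (fun g h => (continuous_segIntegral ha g h).aestronglyMeasurable)
    (norm_segIntegral_le ha) (segIntegral_add_left ha) (segIntegral_smul_left ha)
    (segIntegral_add_right ha) (segIntegral_smul_right ha)

/-- For a field analytic near a closed ball, the translates of its restriction to the sphere
depend analytically on the translation, as elements of `H^{1/2}`. The differences
`c (y + r) - c (y + s)` are integrals of `fderiv c` over segments, so both components of the
ambient Hilbert space are bounded linear images of superposition operators. -/
theorem exists_analytic_trace (ha : 0 < a) (c : E3 → H →L[ℝ] E3) :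
    ∃ Γ : E3 → H →L[ℝ] HHalf a, ∀ y, (∀ r : E3, ‖r‖ ≤ a → AnalyticAt ℝ c (y + r)) →
      AnalyticAt ℝ Γ y ∧ ∀ h, toL2 a (Γ y h) =ᵐ[surf a] fun r => c (y + r) h := by
  obtain ⟨R, hR⟩ := exists_restriction (H := H) ha
  obtain ⟨D, hD⟩ := exists_differences (H := H) ha
  -- Neither summand below lies in `H^{1/2}` by itself before the projection, which is therefore
  -- applied to each of them; it fixes their sum.
  let e := (WithLp.prodContinuousLinearEquiv 2 ℝ (L2 a) (Lp E3 2 (slobMeasure a))).symm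
  let i₁ : L2 a →L[ℝ] HHalf a := (halfProj a).comp
    (e.toContinuousLinearMap.comp (ContinuousLinearMap.inl ℝ _ _))
  let i₂ : Lp E3 2 (slobMeasure a) →L[ℝ] HHalf a := (halfProj a).comp
    (e.toContinuousLinearMap.comp (ContinuousLinearMap.inr ℝ _ _))
  refine ⟨fun y => i₁.comp (R (superpose c (ballIncl a) y)) +
    i₂.comp (D (superpose (fderiv ℝ c) (ballIncl a) y)), fun y hy => ⟨?_, fun h => ?_⟩⟩
  · have h1 : AnalyticAt ℝ (superpose c (ballIncl a)) y :=
      analyticAt_superpose fun k => hy k (mem_closedBall_zero_iff.1 k.2)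
    have h2 : AnalyticAt ℝ (superpose (fderiv ℝ c) (ballIncl a)) y :=
      analyticAt_superpose fun k => (hy k (mem_closedBall_zero_iff.1 k.2)).fderiv
    have l1 := ((ContinuousLinearMap.compL ℝ H _ _ i₁).comp R).analyticAt
      (superpose c (ballIncl a) y)
    have l2 := ((ContinuousLinearMap.compL ℝ H _ _ i₂).comp D).analyticAt
      (superpose (fderiv ℝ c) (ballIncl a) y)
    exact (l1.comp h1).add (l2.comp h2)
  · set g := superpose c (ballIncl a) y with hg
    set g' := superpose (fderiv ℝ c) (ballIncl a) y with hg'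
    have eg : ∀ r, ‖r‖ ≤ a → g (ballRetract ha r) = c (y + r) := by
      intro r hr
      rw [ballRetract_of_norm_le ha hr, hg, superpose_apply fun k : ClosedB a =>
        (hy k (mem_closedBall_zero_iff.1 k.2)).continuousAt]
      rfl
    have eg' : ∀ r, ‖r‖ ≤ a → g' (ballRetract ha r) = fderiv ℝ c (y + r) := by
      intro r hr
      rw [ballRetract_of_norm_le ha hr, hg', superpose_apply fun k : ClosedB a =>
        (hy k (mem_closedBall_zero_iff.1 k.2)).fderiv.continuousAt]
      rfl
    have hseg : ∀ q : E3 × E3, ‖q.1‖ ≤ a → ‖q.2‖ ≤ a →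
        segIntegral ha g' h q = c (y + q.1) h - c (y + q.2) h := by
      intro q h1 h2
      have hmem : ∀ τ ∈ Set.uIcc (0 : ℝ) 1, ‖q.2 + τ • (q.1 - q.2)‖ ≤ a := by
        intro τ hτ
        rw [Set.uIcc_of_le zero_le_one] at hτ
        have := (convex_closedBall (0 : E3) a).add_smul_sub_mem
          (mem_closedBall_zero_iff.2 h2) (mem_closedBall_zero_iff.2 h1) hτ
        exact mem_closedBall_zero_iff.1 this
      have := intervalIntegral.integral_eq_sub_of_hasDerivAt (a := (0 : ℝ)) (b := 1)
        (f := fun τ => c (y + (q.2 + τ • (q.1 - q.2))) h)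
        (f' := fun τ => g' (ballRetract ha (q.2 + τ • (q.1 - q.2))) (q.1 - q.2) h)
        (fun τ hτ => by
          rw [eg' _ (hmem τ hτ)]
          have d1 := (hy _ (hmem τ hτ)).differentiableAt.hasFDerivAt
          have d2 : HasDerivAt (fun τ : ℝ => y + (q.2 + τ • (q.1 - q.2))) (q.1 - q.2) τ := by
            have := (((hasDerivAt_id τ).smul_const (q.1 - q.2)).const_add q.2).const_add y
            rwa [one_smul] at this
          have d3 := d1.comp_hasDerivAt τ d2
          exact (ContinuousLinearMap.apply ℝ E3 h).hasFDerivAt.comp_hasDerivAt τ d3)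
        (intervalIntegrable_segIntegrand ha g' h q)
      rw [segIntegral, this]
      simp
    set p : HalfAmbient a := WithLp.toLp 2 (R g h, D g' h) with hp
    have hpm : p.snd =ᵐ[slobMeasure a] fun q => p.fst q.1 - p.fst q.2 := by
      filter_upwards [hD g' h, (slob_fst a).ae (hR g h), (slob_snd a).ae (hR g h),
        (slob_fst a).ae (ae_surf_norm_le ha), (slob_snd a).ae (ae_surf_norm_le ha)]
        with q e1 e2 e3 n1 n2
      change D g' h q = R g h q.1 - R g h q.2
      rw [e1, e2, e3, hseg q n1 n2, eg _ n1, eg _ n2]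
    have hval : (i₁.comp (R g) + i₂.comp (D g')) h = halfProj a p := by
      change halfProj a (WithLp.toLp 2 (R g h, 0)) + halfProj a (WithLp.toLp 2 (0, D g' h)) = _
      rw [← map_add, hp, ← WithLp.toLp_add]
      simp
    change toL2 a ((i₁.comp (R g) + i₂.comp (D g')) h) =ᵐ[surf a] _
    rw [hval, toL2_eq, halfIncl_halfProj hpm]
    filter_upwards [hR g h, ae_surf_norm_le ha] with r e1 n1
    change R g h r = _
    rw [e1, eg r n1]

end Trace

/-! ### Interaction of two spheres -/

section Interaction

set_option maxSynthPendingDepth 3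

/-- The norm is analytic away from `0`, as `‖z‖⁻¹ = exp (-log (‖z‖²) / 2)`. -/
theorem analyticAt_stokesletCLM (η : ℝ) {z : E3} (hz : z ≠ 0) :
    AnalyticAt ℝ (stokesletCLM η) z := by
  have hpos : 0 < ‖z‖ := norm_pos_iff.2 hz
  have h1 : AnalyticAt ℝ (fun w : E3 => innerSL ℝ w w) z :=
    ((innerSL ℝ (E := E3)).analyticAt_bilinear (z, z)).comp₂ analyticAt_id analyticAt_id
  have h2 : AnalyticAt ℝ (fun w : E3 => ‖w‖⁻¹) z := by
    have e : (fun w : E3 => ‖w‖⁻¹) =ᶠ[nhds z]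
        fun w => Real.exp (-(1 / 2) * Real.log (innerSL ℝ w w)) := by
      filter_upwards [isOpen_ne.mem_nhds hz] with w hw
      have hw' : 0 < ‖w‖ := norm_pos_iff.2 hw
      rw [innerSL_apply_apply, real_inner_self_eq_norm_sq, Real.log_pow, ← Real.exp_log hw',
        ← Real.exp_neg, Real.log_exp]
      congr 1; push_cast; ring
    refine AnalyticAt.congr ?_ e.symm
    refine (analyticAt_const.mul
      ((analyticAt_log ?_).comp (f := fun w : E3 => innerSL ℝ w w) h1)).rexp
    rw [innerSL_apply_apply, real_inner_self_eq_norm_sq]; positivity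
  have h3 : AnalyticAt ℝ (fun w : E3 => (innerSL ℝ w).smulRight w) z :=
    ((ContinuousLinearMap.smulRightL ℝ E3 E3).analyticAt_bilinear (innerSL ℝ z, z)).comp₂
      ((innerSL ℝ (E := E3)).analyticAt z) analyticAt_id
  have e : stokesletCLM η = fun w => (8 * Real.pi * η)⁻¹ •
      (‖w‖⁻¹ • ContinuousLinearMap.id ℝ E3 + (‖w‖⁻¹) ^ 3 • (innerSL ℝ w).smulRight w) := by
    ext1 w; rw [stokesletCLM, inv_pow]
  rw [e]
  exact analyticAt_const.fun_smul
    ((h2.fun_smul analyticAt_const).fun_add ((h2.fun_pow 3).fun_smul h3))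

/-- The pairing of a functional with a vector-valued family of elements of `H^{1/2}`:
`⟪dualPairing A f, v⟫ = f (A v)`. -/
noncomputable def dualPairing (a : ℝ) :
    (E3 →L[ℝ] HHalf a) →L[ℝ] HNegHalf a →L[ℝ] E3 :=
  LinearMap.mkContinuous₂
    (LinearMap.mk₂ ℝ (fun A f => (InnerProductSpace.toDual ℝ E3).symm (f.comp A))
      (fun A B f => by rw [ContinuousLinearMap.comp_add, map_add])
      (fun c A f => by
        rw [ContinuousLinearMap.comp_smul, LinearIsometryEquiv.map_smulₛₗ]; rfl)
      (fun A f g => by rw [ContinuousLinearMap.add_comp, map_add])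
      (fun c A f => by
        rw [ContinuousLinearMap.smul_comp, LinearIsometryEquiv.map_smulₛₗ]; rfl)) 1
    (fun A f => by
      change ‖(InnerProductSpace.toDual ℝ E3).symm (f.comp A)‖ ≤ _
      rw [LinearIsometryEquiv.norm_map, one_mul, mul_comm]
      exact f.opNorm_comp_le A)

theorem inner_dualPairing {a : ℝ} (A : E3 →L[ℝ] HHalf a) (f : HNegHalf a) (v : E3) :
    inner ℝ (dualPairing a A f) v = f (A v) :=
  InnerProductSpace.toDual_symm_apply

theorem stokeslet_neg (η : ℝ) (z v : E3) : stokeslet η (-z) v = stokeslet η z v := by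
  simp [stokeslet]

/-- The interaction of two disjoint spheres, as an analytic function of the difference `y` of the
centres. The trace construction is used twice: for the kernel as a function of the source point,
and then for its pairing with a functional, as a function of the target point. -/
theorem exists_interaction {a : ℝ} (ha : 0 < a) (η : ℝ) :
    ∃ Γ : E3 → HNegHalf a →L[ℝ] HHalf a, ∀ y, 2 * a < ‖y‖ → AnalyticAt ℝ Γ y ∧
      ∀ f, ∀ᵐ r ∂(surf a), ∀ v : E3, ∃ φ : HHalf a,
        (toL2 a φ =ᵐ[surf a] fun s => stokeslet η (y + r - s) v) ∧
          inner ℝ (toL2 a (Γ y f) r) v = f φ := by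
  obtain ⟨K, hK⟩ := exists_analytic_trace ha (stokesletCLM η)
  have hK' : ∀ z : E3, a < ‖z‖ → AnalyticAt ℝ K (-z) ∧
      ∀ v, toL2 a (K (-z) v) =ᵐ[surf a] fun s => stokeslet η (z - s) v := by
    intro z hz
    obtain ⟨h1, h2⟩ := hK (-z) fun r hr => analyticAt_stokesletCLM η fun h0 => by
      have : r = z := by rwa [neg_add_eq_zero, eq_comm] at h0
      rw [this] at hr; linarith
    refine ⟨h1, fun v => (h2 v).trans (Filter.Eventually.of_forall fun s => ?_)⟩
    simp only
    rw [stokesletCLM_apply, ← stokeslet_neg]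
    congr 1; abel
  obtain ⟨Γ, hΓ⟩ := exists_analytic_trace ha fun z => dualPairing a (K (-z))
  have hfar : ∀ y r : E3, 2 * a < ‖y‖ → ‖r‖ ≤ a → a < ‖y + r‖ := by
    intro y r hy hr
    have := norm_sub_le (y + r) r
    rw [add_sub_cancel_right] at this
    linarith
  refine ⟨Γ, fun y hy => ?_⟩
  obtain ⟨h1, h2⟩ := hΓ y fun r hr =>
    ((dualPairing a).analyticAt (K (-(y + r)))).comp (g := dualPairing a) (f := fun z => K (-z)) <|
      (hK' _ (hfar y r hy hr)).1.comp (f := fun z => -z) analyticAt_id.neg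
  refine ⟨h1, fun f => ?_⟩
  filter_upwards [h2 f, ae_surf_norm_le ha] with r hr hra v
  exact ⟨K (-(y + r)) v, (hK' _ (hfar y r hy hra)).2 v, by rw [hr, inner_dualPairing]⟩

theorem norm_stokeslet_le (η : ℝ) (z v : E3) :
    ‖stokeslet η z v‖ ≤ |(8 * Real.pi * η)⁻¹| * (2 * ‖z‖⁻¹) * ‖v‖ := by
  rw [stokeslet, norm_smul, Real.norm_eq_abs, mul_assoc |(8 * Real.pi * η)⁻¹|]
  gcongr
  rcases eq_or_ne z 0 with rfl | hz
  · simp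
  have hpos : 0 < ‖z‖ := norm_pos_iff.2 hz
  calc ‖‖z‖⁻¹ • v + (‖z‖ ^ 3)⁻¹ • (inner ℝ z v • z)‖
      ≤ ‖z‖⁻¹ * ‖v‖ + (‖z‖ ^ 3)⁻¹ * ((‖z‖ * ‖v‖) * ‖z‖) := by
        refine (norm_add_le _ _).trans ?_
        rw [norm_smul, norm_smul, norm_smul, Real.norm_of_nonneg (by positivity : 0 ≤ ‖z‖⁻¹),
          Real.norm_of_nonneg (by positivity : 0 ≤ (‖z‖ ^ 3)⁻¹)]
        gcongr
        exact norm_inner_le_norm _ _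
    _ = 2 * ‖z‖⁻¹ * ‖v‖ := by field_simp; ring

theorem inner_stokeslet_comm (η : ℝ) (z v w : E3) :
    inner ℝ (stokeslet η z v) w = inner ℝ v (stokeslet η z w) := by
  simp only [stokeslet, inner_smul_left, inner_smul_right, inner_add_left, inner_add_right,
    conj_trivial, real_inner_comm z v]
  ring

/-- On densities in `L²` the interaction is given by absolutely convergent integrals. -/
theorem interaction_ofL2 {a : ℝ} (ha : 0 < a) {η : ℝ} {y : E3} (hy : 2 * a < ‖y‖)
    {G : HNegHalf a →L[ℝ] HHalf a}
    (hG : ∀ f, ∀ᵐ r ∂(surf a), ∀ v : E3, ∃ φ : HHalf a,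
        (toL2 a φ =ᵐ[surf a] fun s => stokeslet η (y + r - s) v) ∧
          inner ℝ (toL2 a (G f) r) v = f φ) (f : L2 a) :
    ∀ᵐ r ∂(surf a), Integrable (fun s => stokeslet η (y + r - s) (f s)) (surf a) ∧
      toL2 a (G (ofL2 f)) r = ∫ s, stokeslet η (y + r - s) (f s) ∂(surf a) := by
  have hfm := (Lp.stronglyMeasurable f).measurable
  filter_upwards [hG (ofL2 f), ae_surf_norm_le ha] with r hr hra
  have hi : Integrable (fun s => stokeslet η (y + r - s) (f s)) (surf a) := by
    have hf := (memLp_integrable_surf (Lp.memLp f)).norm.const_mul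
      (|(8 * Real.pi * η)⁻¹| * (2 * (‖y‖ - 2 * a)⁻¹))
    refine hf.mono' (Measurable.aestronglyMeasurable ?_) ?_
    · unfold stokeslet; fun_prop
    · filter_upwards [ae_surf_norm_le ha] with s hs
      refine (norm_stokeslet_le _ _ _).trans ?_
      gcongr
      have h1 := norm_sub_le (y + r - s) r
      have h2 := norm_sub_le (y + r - s - r) (-s)
      rw [show y + r - s - r - -s = y by abel, norm_neg] at h2
      linarith
  refine ⟨hi, ext_inner_right ℝ fun v => ?_⟩
  obtain ⟨φ, h1, h2⟩ := hr v
  rw [h2, ofL2_apply, L2.inner_def, real_inner_comm, ← integral_inner hi]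
  refine integral_congr_ae ?_
  filter_upwards [h1] with s hs
  rw [hs, ← inner_stokeslet_comm, real_inner_comm]

end Interaction

/-! ### The single-layer operator -/

section SingleLayer

set_option maxSynthPendingDepth 3

variable {N : ℕ} {a : ℝ}

/-- The operator on `N`-tuples with entries `A i j`. -/
noncomputable def blockOp (A : Fin N → Fin N → HNegHalf a →L[ℝ] HHalf a) :
    (Fin N → HNegHalf a) →L[ℝ] (Fin N → HHalf a) :=
  ∑ i, ∑ j, (ContinuousLinearMap.single ℝ (fun _ : Fin N => HHalf a) i).comp
    ((A i j).comp (ContinuousLinearMap.proj j))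

theorem blockOp_apply (A : Fin N → Fin N → HNegHalf a →L[ℝ] HHalf a) (f : Fin N → HNegHalf a)
    (i : Fin N) : blockOp A f i = ∑ j, A i j (f j) := by
  simp only [blockOp, sum_apply, ContinuousLinearMap.comp_apply,
    ContinuousLinearMap.proj_apply, ContinuousLinearMap.single_apply, Finset.sum_apply]
  rw [Finset.sum_eq_single i]
  · simp
  · intro k _ hk
    simp [hk.symm]
  · simp

theorem analyticAt_blockOp {E : Type*} [NormedAddCommGroup E] [NormedSpace ℝ E]
    {A : E → Fin N → Fin N → HNegHalf a →L[ℝ] HHalf a} {x : E}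
    (h : ∀ i j, AnalyticAt ℝ (fun y => A y i j) x) : AnalyticAt ℝ (fun y => blockOp (A y)) x := by
  unfold blockOp
  refine Finset.analyticAt_fun_sum _ fun i _ => Finset.analyticAt_fun_sum _ fun j _ => ?_
  let l1 := ((ContinuousLinearMap.compL ℝ (Fin N → HNegHalf a) (HHalf a) (Fin N → HHalf a))
    (ContinuousLinearMap.single ℝ (fun _ : Fin N => HHalf a) i)).comp
      ((ContinuousLinearMap.compL ℝ (Fin N → HNegHalf a) (HNegHalf a) (HHalf a)).flip
        (ContinuousLinearMap.proj j))
  have l2 : AnalyticAt ℝ (fun y => l1 (A y i j)) x :=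
    (l1.analyticAt (A x i j)).comp (g := l1) (f := fun y => A y i j) (h i j)
  exact l2

theorem norm_sub_of_mem_configSet {x : Fin N → E3} (hx : x ∈ configSet N a) {i j : Fin N}
    (hij : i ≠ j) : 2 * a < ‖x i - x j‖ := by
  rcases lt_or_gt_of_ne hij with h | h
  · exact hx i j h
  · rw [norm_sub_rev]; exact hx j i h

theorem isOpen_configSet (N : ℕ) (a : ℝ) : IsOpen (configSet N a) := by
  have : configSet N a = ⋂ i, ⋂ j, ⋂ _ : i < j, {x : Fin N → E3 | 2 * a < ‖x i - x j‖} := by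
    ext x; simp [configSet]
  rw [this]
  exact isOpen_iInter_of_finite fun i => isOpen_iInter_of_finite fun j =>
    isOpen_iInter_of_finite fun _ => isOpen_lt (by fun_prop) (by fun_prop)

/-- The single-layer operators exist and can be chosen analytically in the configuration. -/
theorem exists_singleLayer (N : ℕ) (η : ℝ) (ha : 0 < a) :
    ∃ T : (Fin N → E3) → ((Fin N → HNegHalf a) →L[ℝ] (Fin N → HHalf a)),
      ∀ x ∈ configSet N a, IsSingleLayer η a x (T x) ∧ AnalyticAt ℝ T x := by
  obtain ⟨S, hS⟩ := isHalfKernel_stokeslet ha η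
  obtain ⟨Γ, hΓ⟩ := exists_interaction ha η
  refine ⟨fun x => blockOp fun i j => if i = j then S else Γ (x i - x j),
    fun x hx => ⟨⟨?_, ?_⟩, ?_⟩⟩
  · intro f i
    have key : ∀ j, ∀ᵐ r ∂(surf a),
        Integrable (fun s => stokeslet η (x i - x j + r - s) (f j s)) (surf a) ∧
        toL2 a ((if i = j then S else Γ (x i - x j)) (ofL2 (f j))) r =
          ∫ s, stokeslet η (x i - x j + r - s) (f j s) ∂(surf a) := by
      intro j
      split_ifs with hij
      · subst hij
        simpa only [stokesletCLM_apply, sub_self, zero_add] using hS (f i)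
      · have hy := norm_sub_of_mem_configSet hx hij
        exact interaction_ofL2 ha hy (hΓ _ hy).2 (f j)
    filter_upwards [ae_all_iff.2 key, Lp.coeFn_fun_finsetSum Finset.univ fun j =>
      toL2 a ((if i = j then S else Γ (x i - x j)) (ofL2 (f j)))] with r hr hs
    refine ⟨fun j => (hr j).1, ?_⟩
    rw [blockOp_apply, map_sum, hs]
    exact Finset.sum_congr rfl fun j _ => (hr j).2
  · intro i j hij f
    have hy := norm_sub_of_mem_configSet hx hij
    have e : blockOp (fun i j => if i = j then S else Γ (x i - x j)) (Pi.single j f) i =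
        Γ (x i - x j) f := by
      rw [blockOp_apply, Finset.sum_eq_single j]
      · rw [if_neg hij, Pi.single_eq_same]
      · intro k _ hk
        rw [Pi.single_eq_of_ne hk, map_zero]
      · simp
    rw [e]
    exact (hΓ _ hy).2 f
  · refine analyticAt_blockOp fun i j => ?_
    by_cases hij : i = j
    · simp only [hij, if_true]; exact analyticAt_const
    · simp only [hij, if_false]
      have hy := norm_sub_of_mem_configSet hx hij
      have l : AnalyticAt ℝ (fun y : Fin N → E3 => y i - y j) x :=
        ((ContinuousLinearMap.proj (R := ℝ) (φ := fun _ : Fin N => E3) i) -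
          (ContinuousLinearMap.proj (R := ℝ) (φ := fun _ : Fin N => E3) j)).analyticAt x
      exact (hΓ _ hy).1.comp (f := fun y : Fin N → E3 => y i - y j) l

/-- The integral formula on the dense subspace `L²` determines the operator. -/
theorem IsSingleLayer.unique {η : ℝ} {x : Fin N → E3}
    {T T' : (Fin N → HNegHalf a) →L[ℝ] (Fin N → HHalf a)} (h : IsSingleLayer η a x T)
    (h' : IsSingleLayer η a x T') : T = T' := by
  have hd : DenseRange fun (f : Fin N → L2 a) (j : Fin N) => ofL2 (f j) :=
    DenseRange.piMap fun _ => denseRange_ofL2 a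
  refine ContinuousLinearMap.ext fun F => congrFun (hd.equalizer T.continuous T'.continuous
    (funext fun f => ?_)) F
  refine funext fun i => toL2_injective a (Lp.ext ?_)
  filter_upwards [h.density f i, h'.density f i] with r h1 h2
  exact h1.2.trans h2.2.symm

end SingleLayer

end Stokes

theorem mainTheorem3 (N : ℕ) (η a : ℝ) (hη : 0 < η) (ha : 0 < a) :
    (∀ x ∈ Stokes.configSet N a,
      ∃! T : (Fin N → Stokes.HNegHalf a) →L[ℝ] (Fin N → Stokes.HHalf a),
        Stokes.IsSingleLayer η a x T) ∧
    ∀ T : (Fin N → Stokes.E3) →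
        ((Fin N → Stokes.HNegHalf a) →L[ℝ] (Fin N → Stokes.HHalf a)),
      (∀ x ∈ Stokes.configSet N a, Stokes.IsSingleLayer η a x (T x)) →
      AnalyticOnNhd ℝ T (Stokes.configSet N a) := by
  obtain ⟨S, hS⟩ := Stokes.exists_singleLayer N η ha
  refine ⟨fun x hx => ⟨S x, (hS x hx).1, fun T hT => hT.unique (hS x hx).1⟩, fun T hT x hx => ?_⟩
  refine (hS x hx).2.congr ?_
  filter_upwards [(Stokes.isOpen_configSet N a).mem_nhds hx] with y hy
  exact (hS y hy).1.unique (hT y hy)
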